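/- Let $\sigma>0$, $b\in\mathbb{R}$, $\lambda>0$, $\lambda_+>1$, $\lambda_->0$, $p\in(0,1)$ and $T>0$. In Kou's double-exponential jump diffusion model the log-return is $$X_t = bt+\sigma W_t+\sum_{j=1}^{N_t}Y_j ,$$ where $W$ is a standard Brownian motion, $N$ is a Poisson process with intensity $\lambda$, the jumps $Y_1,Y_2,\dots$ are i.i.d. with density $$f(y)=p\lambda_+e^{-\lambda_+y}\mathbf 1_{[0,\infty)}(y)+(1-p)\lambda_-e^{\lambda_-y}\mathbf 1_{(-\infty,0)}(y),$$ and $W$, $N$ and $(Y_j)_{j\ge1}$ are independent. Let $S_t=e^{X_t}$ (initial spot $1$, zero interest rate), and let $C(k,T)=\mathbb{E}[(S_T-e^k)^+]$ be the price of the call with log-strike $k$ and maturity $T$. Then $C(k,T)$ is finite for every $k\in\mathbb{R}$ and, for fixed $T$ and model parameters, $$C(k,T)=\exp\left(-\alpha_1k-\alpha_{1/2}k^{1/2}-\alpha_0\right)k^{-3/4}\left(1+O(k^{-1/4})\right)\qquad\text{as } k\to\infty,$$ where $$\alpha_1=\lambda_+-1,\qquad \alpha_{1/2}=-2(\lambda\lambda_+pT)^{1/2},$$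 $$\alpha_0=T\left(-\frac{\sigma^2\lambda_+^2}{2}-b\lambda_+-\frac{\lambda\lambda_-(1-p)}{\lambda_-+\lambda_+}+\lambda\right)-\log\frac{(\lambda\lambda_+pT)^{1/4}}{2\sqrt{\pi}\,\lambda_+(\lambda_+-1)} .$$ -/

import Mathlib

open MeasureTheory ProbabilityTheory Filter Asymptotics
open scoped NNReal

/-- The density `p λ₊ e^{-λ₊ y} 1_{[0,∞)}(y) + (1-p) λ₋ e^{λ₋ y} 1_{(-∞,0)}(y)`. -/
noncomputable def kouDensity (lamPlus lamMinus p : ℝ) (y : ℝ) : ℝ :=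
  (Set.Ici (0 : ℝ)).indicator (fun y => p * lamPlus * Real.exp (-lamPlus * y)) y +
    (Set.Iio (0 : ℝ)).indicator (fun y => (1 - p) * lamMinus * Real.exp (lamMinus * y)) y

/-- The double exponential distribution: the law on `ℝ` with density `kouDensity`. -/
noncomputable def kouJumpLaw (lamPlus lamMinus p : ℝ) : Measure ℝ :=
  volume.withDensity (fun y => ENNReal.ofReal (kouDensity lamPlus lamMinus p y))

/-- `N` is a (homogeneous) Poisson process with intensity `r`: it starts at `0`, has independent
increments, `N t - N s` is Poisson distributed with parameter `r (t - s)` for `s ≤ t`, and almost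
all its paths are nondecreasing and right-continuous (hence càdlàg). -/
structure IsPoissonProcess {Ω : Type*} [MeasurableSpace Ω] (N : ℝ≥0 → Ω → ℕ) (r : ℝ≥0)
    (P : Measure Ω) : Prop where
  measurable : ∀ t, Measurable (N t)
  zero : ∀ᵐ ω ∂P, N 0 ω = 0
  indep_increments : HasIndepIncrements (fun t ω => (N t ω : ℝ)) P
  law_increment : ∀ s t : ℝ≥0, s ≤ t →
    HasLaw (fun ω => (N t ω : ℝ) - (N s ω : ℝ))
      ((poissonMeasure (r * (t - s))).map (fun n : ℕ => (n : ℝ))) P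
  paths : ∀ᵐ ω ∂P, Monotone (fun t => N t ω) ∧
    ∀ t, ContinuousWithinAt (fun t => N t ω) (Set.Ici t) t

/-- The random inputs of the Kou model on `(Ω, P)`: a standard Brownian motion `W`, a Poisson
process `N` with intensity `lam`, and i.i.d. double exponential jumps `Y 0, Y 1, …`. The last two
fields say that the path of `W`, the path of `N` and the sequence `Y` are mutually independent. -/
structure IsKouModel {Ω : Type*} [MeasurableSpace Ω] (P : Measure Ω)
    (W : ℝ≥0 → Ω → ℝ) (N : ℝ≥0 → Ω → ℕ) (Y : ℕ → Ω → ℝ)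
    (lam : ℝ≥0) (lamPlus lamMinus p : ℝ) : Prop where
  measurable_W : ∀ t, Measurable (W t)
  brownian : IsBrownianReal W P
  poisson : IsPoissonProcess N lam P
  measurable_Y : ∀ j, Measurable (Y j)
  law_Y : ∀ j, HasLaw (Y j) (kouJumpLaw lamPlus lamMinus p) P
  indep_Y : iIndepFun Y P
  indep_W : IndepFun (fun ω t => W t ω)
    (fun ω => ((fun t => N t ω, fun j => Y j ω) : (ℝ≥0 → ℕ) × (ℕ → ℝ))) P
  indep_N_Y : IndepFun (fun ω t => N t ω) (fun ω j => Y j ω) P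

/-- The log-return `X_t = b t + σ W_t + (sum of the first N_t jumps)`; the jumps `Y_1, Y_2, …` are
enumerated from `0`. -/
noncomputable def logReturn {Ω : Type*} (b σ : ℝ) (W : ℝ≥0 → Ω → ℝ) (N : ℝ≥0 → Ω → ℕ)
    (Y : ℕ → Ω → ℝ) (t : ℝ≥0) (ω : Ω) : ℝ :=
  b * (t : ℝ) + σ * W t ω + ∑ j ∈ Finset.range (N t ω), Y j ω

/-- The price `E[(S_T - e^k)^+]`, `S_T = e^{X_T}`, of a call with log-strike `k` and maturity `T`
(zero interest rate, initial spot `1`), for the log-return process `X`. -/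
noncomputable def callPrice {Ω : Type*} [MeasurableSpace Ω] (P : Measure Ω)
    (X : ℝ≥0 → Ω → ℝ) (k : ℝ) (T : ℝ≥0) : ℝ :=
  ∫ ω, max (Real.exp (X T ω) - Real.exp k) 0 ∂P

noncomputable def kouAlphaOne (lamPlus : ℝ) : ℝ := lamPlus - 1

noncomputable def kouAlphaHalf (lam lamPlus p T : ℝ) : ℝ :=
  -2 * (lam * lamPlus * p * T) ^ (1 / 2 : ℝ)

noncomputable def kouAlphaZero (b σ lam lamPlus lamMinus p T : ℝ) : ℝ :=
  T * (-(σ ^ 2 * lamPlus ^ 2 / 2) - b * lamPlus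
      - lam * lamMinus * (1 - p) / (lamMinus + lamPlus) + lam)
    - Real.log ((lam * lamPlus * p * T) ^ (1 / 4 : ℝ)
        / (2 * Real.sqrt Real.pi * lamPlus * (lamPlus - 1)))

/-! By Poisson thinning, the log-return at `T` has the law of `Z + V` with `Z` and `V` independent.
Here `Z` collects drift, Brownian part and negative jumps, and `V` is compound Poisson with
parameter `a = λTp` and exponential jumps of rate `r = λ₊`. The splitting is proved with
characteristic functions (`IsKouModel.map_logReturn`).

The law of `V` is explicit: an atom `e^{-a}` at `0`, and on `(0, ∞)` the density `e^{-a} e^{-rx}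
h(x)`, where `h(x) = A * besselSeries (A x)` and `A = a r`. A semicircle integral for the Bessel
series and Laplace's method at its endpoint give `h(k) ≈ κ e^{2√(Ak)} k^{-3/4}` with `κ = A^{1/4} /
(2√π)`.

With `w = Z + V - k`, the absolutely continuous part of the price becomes `e^{-a} e^{-(r-1)k} E ∫
e^{rZ} (e^w - 1) e^{-rw} h(k + w - Z) dw` over `w > 0`. Since `h` is subexponential, shifting its
argument from `k` by `u` costs a relative error `O(k^{-1/2})`, up to a weight `e^{δ|u|}`
(`exists_abs_shift_sub_le`). This weight is integrable for small `δ`: `Z` has all positive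
exponential moments and `r > 1`. Hence `h(k + w - Z)` may be replaced by the profile at `k`, leaving
the constant `E e^{rZ} / (r(r-1))`. The atom of `V` contributes only a relative error of order
`e^{-k}` against a subexponential profile. The relative error obtained is `O(k^{-1/2})`, stronger
than the required `O(k^{-1/4})`. -/

/-! ### The Bessel series: integral representation and asymptotics -/

/-- The entire function `y ↦ ∑ yᵐ / (m! (m+1)!)`, equal to `I₁(2√y)/√y` for `y > 0`. -/
noncomputable def besselSeries (y : ℝ) : ℝ :=
  ∑' m : ℕ, y ^ m / ((m.factorial : ℝ) * ((m + 1).factorial : ℝ))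

theorem summable_besselSeries (y : ℝ) :
    Summable fun m : ℕ => y ^ m / ((m.factorial : ℝ) * ((m + 1).factorial : ℝ)) := by
  refine Summable.of_norm_bounded (Real.summable_pow_div_factorial |y|) fun m => ?_
  rw [norm_div, norm_pow, Real.norm_eq_abs, Real.norm_of_nonneg (by positivity)]
  have h1 : (1 : ℝ) ≤ ((m + 1).factorial : ℝ) := by
    exact_mod_cast Nat.one_le_iff_ne_zero.2 (Nat.factorial_ne_zero _)
  have h0 : (0 : ℝ) < (m.factorial : ℝ) := by positivity
  gcongr
  nlinarith

theorem besselSeries_nonneg {y : ℝ} (hy : 0 ≤ y) : 0 ≤ besselSeries y :=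
  tsum_nonneg fun m => by positivity

theorem continuousOn_sqrt_mul_pow (n : ℕ) (s : Set ℝ) :
    ContinuousOn (fun t : ℝ => √(1 - t ^ 2) * t ^ n) s := by fun_prop

/-- The recurrence between the even moments of the semicircle. -/
theorem integral_sqrt_one_sub_sq_mul_pow_succ (m : ℕ) :
    (2 * m + 4 : ℝ) * ∫ t in (-1 : ℝ)..1, √(1 - t ^ 2) * t ^ (2 * (m + 1))
      = (2 * m + 1) * ∫ t in (-1 : ℝ)..1, √(1 - t ^ 2) * t ^ (2 * m) := by
  have hint (n : ℕ) : IntervalIntegrable (fun t : ℝ => √(1 - t ^ 2) * t ^ n) volume (-1) 1 :=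
    (continuousOn_sqrt_mul_pow n _).intervalIntegrable
  have key : ∫ t in (-1 : ℝ)..1, ((2 * m + 1) * (√(1 - t ^ 2) * t ^ (2 * m))
      - (2 * m + 4) * (√(1 - t ^ 2) * t ^ (2 * (m + 1)))) = 0 := by
    -- The integrand is the derivative of `t^(2m+1) (1 - t²)^(3/2)`, which vanishes at both
    -- endpoints.
    rw [intervalIntegral.integral_eq_sub_of_hasDerivAt_of_le (by norm_num)
      (f := fun t : ℝ => t ^ (2 * m + 1) * ((1 - t ^ 2) * √(1 - t ^ 2)))]
    · norm_num
    · fun_prop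
    · intro t ht
      have h1 : 0 < 1 - t ^ 2 := by nlinarith [ht.1, ht.2]
      have h2 : √(1 - t ^ 2) ≠ 0 := (Real.sqrt_pos.2 h1).ne'
      have d1 : HasDerivAt (fun t : ℝ => 1 - t ^ 2) (-(2 * t)) t := by
        simpa using (hasDerivAt_pow 2 t).const_sub 1
      have d2 := d1.sqrt h1.ne'
      have d3 := (hasDerivAt_pow (2 * m + 1) t).mul (d1.mul d2)
      convert! d3 using 1
      have h3 : √(1 - t ^ 2) ^ 2 = 1 - t ^ 2 := Real.sq_sqrt h1.le
      simp only [Nat.add_sub_cancel]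
      push_cast
      have h4 : (1 - t ^ 2) * (-(2 * t) / (2 * √(1 - t ^ 2))) = - t * √(1 - t ^ 2) := by
        field_simp
        rw [h3]
      rw [show 2 * (m + 1) = 2 * m + 2 by ring]
      rw [h4]
      simp only [Pi.mul_apply]
      ring
    · exact ((hint _).const_mul _).sub ((hint _).const_mul _)
  rw [intervalIntegral.integral_sub ((hint _).const_mul _) ((hint _).const_mul _),
    intervalIntegral.integral_const_mul, intervalIntegral.integral_const_mul] at key
  linarith

theorem integral_sqrt_one_sub_sq_mul_pow_even (m : ℕ) :
    ∫ t in (-1 : ℝ)..1, √(1 - t ^ 2) * t ^ (2 * m) =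
      Real.pi / 2 * ((2 * m).factorial / (4 ^ m * m.factorial * (m + 1).factorial)) := by
  induction m with
  | zero => simp [integral_sqrt_one_sub_sq]
  | succ m ih =>
    have h := integral_sqrt_one_sub_sq_mul_pow_succ m
    rw [ih] at h
    rw [← mul_right_inj' (show (2 * m + 4 : ℝ) ≠ 0 by positivity), h]
    rw [show 2 * (m + 1) = 2 * m + 1 + 1 by ring]
    simp only [Nat.factorial_succ, pow_succ]
    push_cast
    field_simp
    ring

theorem integral_sqrt_one_sub_sq_mul_pow_odd (m : ℕ) :
    ∫ t in (-1 : ℝ)..1, √(1 - t ^ 2) * t ^ (2 * m + 1) = 0 := by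
  have h := intervalIntegral.integral_comp_neg (a := -1) (b := 1)
    (fun t : ℝ => √(1 - t ^ 2) * t ^ (2 * m + 1))
  simp only [neg_neg, even_two, Even.neg_pow, Odd.neg_pow ⟨m, rfl⟩, mul_neg,
    intervalIntegral.integral_neg] at h
  linarith

theorem hasSum_integral_sqrt_mul_exp (x : ℝ) :
    HasSum (fun n : ℕ => x ^ n / n.factorial * ∫ t in (-1 : ℝ)..1, √(1 - t ^ 2) * t ^ n)
      (∫ t in (-1 : ℝ)..1, √(1 - t ^ 2) * Real.exp (x * t)) := by
  have h := intervalIntegral.hasSum_integral_of_dominated_convergence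
    (μ := volume) (a := -1) (b := 1)
    (F := fun (n : ℕ) (t : ℝ) => x ^ n / n.factorial * (√(1 - t ^ 2) * t ^ n))
    (f := fun t => √(1 - t ^ 2) * Real.exp (x * t))
    (fun n _ => |x| ^ n / n.factorial) ?_ ?_ ?_ ?_ ?_
  · simpa only [intervalIntegral.integral_const_mul] using h
  · intro n
    exact Continuous.aestronglyMeasurable (by fun_prop)
  · intro n
    refine Eventually.of_forall fun t ht => ?_
    rw [Set.uIoc_of_le (by norm_num)] at ht
    rw [norm_mul, norm_div, norm_pow, Real.norm_eq_abs, Real.norm_of_nonneg (by positivity)]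
    have h1 : ‖√(1 - t ^ 2) * t ^ n‖ ≤ 1 := by
      rw [norm_mul, norm_pow, Real.norm_of_nonneg (Real.sqrt_nonneg _)]
      refine mul_le_one₀ ?_ (by positivity) (pow_le_one₀ (norm_nonneg _) ?_)
      · exact Real.sqrt_le_one.2 (by nlinarith [sq_nonneg t])
      · exact abs_le.2 ⟨ht.1.le, ht.2⟩
    exact mul_le_of_le_one_right (by positivity) h1
  · exact Eventually.of_forall fun t _ => Real.summable_pow_div_factorial |x|
  · exact intervalIntegrable_const
  · refine Eventually.of_forall fun t _ => ?_
    have := (NormedSpace.expSeries_div_hasSum_exp (x * t)).mul_left (√(1 - t ^ 2))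
    rw [← Real.exp_eq_exp_ℝ] at this
    refine this.congr_fun fun n => ?_
    simp only [mul_pow]; ring

/-- Expand the exponential: odd semicircle moments vanish by symmetry, and the even ones, which are
scaled Catalan numbers, turn `(2√y)^(2m) / (2m)!` into the series coefficients. The integral form
makes Laplace's method available. -/
theorem besselSeries_eq_integral {y : ℝ} (hy : 0 ≤ y) :
    besselSeries y =
      2 / Real.pi * ∫ t in (-1 : ℝ)..1, √(1 - t ^ 2) * Real.exp (2 * √y * t) := by
  have h := hasSum_integral_sqrt_mul_exp (2 * √y)
  have h2 : HasSum (fun m : ℕ => (2 * √y) ^ (2 * m) / (2 * m).factorial *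
      ∫ t in (-1 : ℝ)..1, √(1 - t ^ 2) * t ^ (2 * m))
      (∫ t in (-1 : ℝ)..1, √(1 - t ^ 2) * Real.exp (2 * √y * t)) := by
    refine (Function.Injective.hasSum_iff (f := fun n : ℕ => (2 * √y) ^ n / n.factorial *
      ∫ t in (-1 : ℝ)..1, √(1 - t ^ 2) * t ^ n) (g := fun m : ℕ => 2 * m) ?_ ?_).2 h
    · intro a b hab; simpa using hab
    · intro n hn
      obtain ⟨m, hm | hm⟩ := n.even_or_odd'
      · exact absurd ⟨m, hm.symm⟩ hn
      · rw [hm, integral_sqrt_one_sub_sq_mul_pow_odd, mul_zero]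
  rw [besselSeries, ← (h2.mul_left (2 / Real.pi)).tsum_eq]
  congr 1; ext m
  rw [integral_sqrt_one_sub_sq_mul_pow_even, pow_mul, mul_pow, Real.sq_sqrt hy, mul_pow]
  have := Real.pi_ne_zero
  norm_num
  field_simp

theorem continuous_besselSeries : Continuous besselSeries := by
  refine continuous_iff_continuousAt.2 fun y => ?_
  have h : ContinuousOn besselSeries (Metric.ball 0 (|y| + 1)) := by
    unfold besselSeries
    refine continuousOn_tsum
      (f := fun (m : ℕ) (x : ℝ) => x ^ m / ((m.factorial : ℝ) * ((m + 1).factorial : ℝ)))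
      (u := fun m => (|y| + 1) ^ m / m.factorial)
      (fun m => ((continuous_pow m).div_const _).continuousOn)
      (Real.summable_pow_div_factorial _) fun m x hx => ?_
    have h1 : (1 : ℝ) ≤ ((m + 1).factorial : ℝ) := by
      exact_mod_cast Nat.one_le_iff_ne_zero.2 (Nat.factorial_ne_zero _)
    have h0 : (0 : ℝ) < (m.factorial : ℝ) := by positivity
    rw [norm_div, norm_pow, Real.norm_of_nonneg (by positivity : (0 : ℝ) ≤ _ * _)]
    gcongr
    · simpa using (mem_ball_zero_iff.1 hx).le
    · nlinarith
  exact h.continuousAt (Metric.isOpen_ball.mem_nhds (by simp))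

theorem besselSeries_le_exp {y : ℝ} (hy : 0 ≤ y) : besselSeries y ≤ Real.exp (2 * √y) := by
  rw [besselSeries_eq_integral hy]
  have h : ∫ t in (-1 : ℝ)..1, √(1 - t ^ 2) * Real.exp (2 * √y * t) ≤
      ∫ t in (-1 : ℝ)..1, √(1 - t ^ 2) * Real.exp (2 * √y) := by
    refine intervalIntegral.integral_mono_on (by norm_num) ?_ ?_ fun t ht => ?_
    · exact Continuous.intervalIntegrable (by fun_prop) _ _
    · exact Continuous.intervalIntegrable (by fun_prop) _ _
    · refine mul_le_mul_of_nonneg_left (Real.exp_le_exp.2 ?_) (Real.sqrt_nonneg _)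
      exact mul_le_of_le_one_right (by positivity : 0 ≤ 2 * √y) ht.2
  rw [intervalIntegral.integral_mul_const, integral_sqrt_one_sub_sq] at h
  have hpi := Real.pi_pos
  calc _ ≤ 2 / Real.pi * (Real.pi / 2 * Real.exp (2 * √y)) := by gcongr
    _ = _ := by field_simp

/-- No upper bound on `u` is needed, because the real square root is `0` at negative arguments. The
estimate can therefore be integrated over the whole half-line. -/
theorem abs_sqrt_two_sub_sub_le {u : ℝ} (hu : 0 ≤ u) : |√(2 - u) - √2| ≤ u / √2 := by
  have h2 : 0 < √2 := by positivity
  have hs : √2 * √2 = 2 := Real.mul_self_sqrt (by norm_num)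
  have hle : √(2 - u) ≤ √2 := Real.sqrt_le_sqrt (by linarith)
  rw [abs_sub_comm, abs_of_nonneg (by linarith), le_div_iff₀ h2]
  rcases le_total u 2 with h | h
  · have h3 : √(2 - u) * √(2 - u) = 2 - u := Real.mul_self_sqrt (by linarith)
    nlinarith [Real.sqrt_nonneg (2 - u)]
  · rw [Real.sqrt_eq_zero_of_nonpos (by linarith : 2 - u ≤ 0)]; linarith

/-- Substitute `t = 1 - u` to centre the integral at the maximum of the exponent. Extending the
range from `(0, 2]` to `(0, ∞)` is free, since `√(2 - u)` is `0` beyond `2`. -/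
theorem integral_sqrt_mul_exp_eq (x : ℝ) :
    ∫ t in (-1 : ℝ)..1, √(1 - t ^ 2) * Real.exp (x * t) =
      Real.exp x * ∫ u in Set.Ioi (0 : ℝ), √(2 - u) * (u ^ (1 / 2 : ℝ) * Real.exp (-(x * u))) := by
  have h := intervalIntegral.integral_comp_sub_left (a := 0) (b := 2)
    (fun t : ℝ => √(1 - t ^ 2) * Real.exp (x * t)) 1
  rw [show (1 : ℝ) - 2 = -1 by norm_num, sub_zero] at h
  rw [← h, ← integral_const_mul, intervalIntegral.integral_of_le (by norm_num)]
  rw [setIntegral_eq_of_subset_of_forall_sdiff_eq_zero measurableSet_Ioi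
    (s := Set.Ioc 0 2) Set.Ioc_subset_Ioi_self]
  · refine setIntegral_congr_fun measurableSet_Ioc fun u hu => ?_
    rw [show 1 - (1 - u) ^ 2 = (2 - u) * u by ring, Real.sqrt_mul (by linarith [hu.2]),
      Real.sqrt_eq_rpow u, show x * (1 - u) = x + -(x * u) by ring, Real.exp_add]
    ring
  · intro u hu
    have : 2 - u ≤ 0 := by
      by_contra hc
      exact hu.2 ⟨hu.1, by linarith⟩
    rw [Real.sqrt_eq_zero_of_nonpos this]; ring

theorem integrableOn_rpow_mul_exp_neg_mul {s x : ℝ} (hs : -1 < s) (hx : 0 < x) :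
    IntegrableOn (fun u : ℝ => u ^ s * Real.exp (-(x * u))) (Set.Ioi 0) := by
  simpa [Real.rpow_one, neg_mul] using
    integrableOn_rpow_mul_exp_neg_mul_rpow (p := 1) hs one_pos hx

/-- Watson's lemma to first order: replacing `√(2 - u)` by `√2` leaves a `Γ(3/2)` integral, and the
error `u / √2` produces a `Γ(5/2)` integral. -/
theorem abs_integral_sqrt_sub_le {x : ℝ} (hx : 0 < x) :
    |(∫ u in Set.Ioi (0 : ℝ), √(2 - u) * (u ^ (1 / 2 : ℝ) * Real.exp (-(x * u)))) -
      √2 * ((1 / x) ^ (3 / 2 : ℝ) * (√Real.pi / 2))| ≤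
    1 / √2 * ((1 / x) ^ (5 / 2 : ℝ) * (3 / 4 * √Real.pi)) := by
  have g3 : Real.Gamma (3 / 2) = √Real.pi / 2 := by
    rw [show (3 / 2 : ℝ) = 1 / 2 + 1 by norm_num, Real.Gamma_add_one (by norm_num),
      Real.Gamma_one_half_eq]; ring
  have g5 : Real.Gamma (5 / 2) = 3 / 4 * √Real.pi := by
    rw [show (5 / 2 : ℝ) = 3 / 2 + 1 by norm_num, Real.Gamma_add_one (by norm_num), g3]; ring
  have i3 := Real.integral_rpow_mul_exp_neg_mul_Ioi (a := 3 / 2) (by norm_num) hx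
  have i5 := Real.integral_rpow_mul_exp_neg_mul_Ioi (a := 5 / 2) (by norm_num) hx
  rw [show (3 / 2 : ℝ) - 1 = 1 / 2 by norm_num] at i3
  rw [show (5 / 2 : ℝ) - 1 = 3 / 2 by norm_num] at i5
  have I3 := integrableOn_rpow_mul_exp_neg_mul (s := 1 / 2) (by norm_num) hx
  have I5 := integrableOn_rpow_mul_exp_neg_mul (s := 3 / 2) (by norm_num) hx
  have hbd : ∀ u ∈ Set.Ioi (0 : ℝ),
      ‖√(2 - u) * (u ^ (1 / 2 : ℝ) * Real.exp (-(x * u))) -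
        √2 * (u ^ (1 / 2 : ℝ) * Real.exp (-(x * u)))‖ ≤
      1 / √2 * (u ^ (3 / 2 : ℝ) * Real.exp (-(x * u))) := by
    intro u hu
    have hu' : 0 < u := hu
    rw [← sub_mul, norm_mul, Real.norm_eq_abs,
      Real.norm_of_nonneg (by positivity : 0 ≤ u ^ (1 / 2 : ℝ) * Real.exp (-(x * u))),
      show (3 / 2 : ℝ) = 1 + 1 / 2 by norm_num, Real.rpow_add hu', Real.rpow_one]
    calc _ ≤ u / √2 * (u ^ (1 / 2 : ℝ) * Real.exp (-(x * u))) := by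
          gcongr; exact abs_sqrt_two_sub_sub_le hu'.le
      _ = _ := by ring
  have hd : IntegrableOn (fun u : ℝ => √(2 - u) * (u ^ (1 / 2 : ℝ) * Real.exp (-(x * u))) -
        √2 * (u ^ (1 / 2 : ℝ) * Real.exp (-(x * u)))) (Set.Ioi 0) := by
    refine Integrable.mono' (I5.const_mul _) ?_ ((ae_restrict_iff' measurableSet_Ioi).2
      (Eventually.of_forall hbd))
    exact Measurable.aestronglyMeasurable (by fun_prop)
  have hJ : IntegrableOn (fun u : ℝ => √(2 - u) * (u ^ (1 / 2 : ℝ) * Real.exp (-(x * u))))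
      (Set.Ioi 0) := by
    refine (hd.add (I3.const_mul √2)).congr (Eventually.of_forall fun u => ?_)
    simp
  rw [← g3, ← g5, ← i3, ← i5, ← integral_const_mul, ← integral_const_mul,
    ← integral_sub hJ (I3.const_mul _), ← Real.norm_eq_abs]
  exact norm_integral_le_of_norm_le (I5.const_mul _)
    ((ae_restrict_iff' measurableSet_Ioi).2 (Eventually.of_forall hbd))

/-- The leading term of `besselSeries` at infinity, with relative error `O(y^{-1/2})`. -/
theorem abs_besselSeries_sub_le {y : ℝ} (hy : 0 < y) :
    |besselSeries y - Real.exp (2 * √y) / (2 * √Real.pi * y ^ (3 / 4 : ℝ))| ≤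
      Real.exp (2 * √y) / (2 * √Real.pi * y ^ (3 / 4 : ℝ)) / √y := by
  have hs : 0 < √y := Real.sqrt_pos.2 hy
  have h := abs_integral_sqrt_sub_le (x := 2 * √y) (by positivity)
  rw [besselSeries_eq_integral hy.le, integral_sqrt_mul_exp_eq]
  set J := ∫ u in Set.Ioi (0 : ℝ), √(2 - u) * (u ^ (1 / 2 : ℝ) * Real.exp (-(2 * √y * u)))
  have hpi : √Real.pi * √Real.pi = Real.pi := Real.mul_self_sqrt Real.pi_pos.le
  have hpi2 : 2 / Real.pi = 2 / (√Real.pi * √Real.pi) := by rw [hpi]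
  have hpp : 0 < √Real.pi := Real.sqrt_pos.2 Real.pi_pos
  have h22 : √2 * √2 = (2 : ℝ) := Real.mul_self_sqrt (by norm_num)
  have h2p : 0 < √2 := by positivity
  have hq : 0 < y ^ (3 / 4 : ℝ) := by positivity
  have e1 : (1 / (2 * √y)) ^ (3 / 2 : ℝ) = 1 / (2 * √2 * y ^ (3 / 4 : ℝ)) := by
    rw [Real.div_rpow (by norm_num) (by positivity), Real.one_rpow,
      Real.mul_rpow (by norm_num) hs.le, show (3 / 2 : ℝ) = 1 + 1 / 2 by norm_num,
      Real.rpow_add (by norm_num) 1, Real.rpow_one, ← Real.sqrt_eq_rpow 2, Real.sqrt_eq_rpow y,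
      ← Real.rpow_mul hy.le]
    norm_num
  have e2 : (1 / (2 * √y)) ^ (5 / 2 : ℝ) = 1 / (2 * √2 * y ^ (3 / 4 : ℝ)) / (2 * √y) := by
    rw [← e1, show (5 / 2 : ℝ) = 3 / 2 + 1 by norm_num, Real.rpow_add (by positivity),
      Real.rpow_one]; ring
  rw [e1, e2] at h
  have m1 : 2 / Real.pi * (Real.exp (2 * √y) * J) -
      Real.exp (2 * √y) / (2 * √Real.pi * y ^ (3 / 4 : ℝ)) = 2 / Real.pi * Real.exp (2 * √y) *
      (J - √2 * (1 / (2 * √2 * y ^ (3 / 4 : ℝ)) * (√Real.pi / 2))) := by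
    rw [hpi2]; field_simp
  rw [m1, abs_mul, abs_of_nonneg (by positivity)]
  refine (mul_le_mul_of_nonneg_left h (by positivity)).trans ?_
  rw [hpi2]
  -- The exact constant is `3/8`, which is then relaxed to `1`.
  have m2 : 2 / (√Real.pi * √Real.pi) * Real.exp (2 * √y) *
      (1 / √2 * (1 / (2 * √2 * y ^ (3 / 4 : ℝ)) / (2 * √y) * (3 / 4 * √Real.pi))) =
      3 / 8 * (Real.exp (2 * √y) / (2 * √Real.pi * y ^ (3 / 4 : ℝ)) / √y) := by
    have : √2 ^ 2 = (2 : ℝ) := by rw [sq, h22]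
    field_simp; rw [this]; ring
  rw [m2]
  have : 0 ≤ Real.exp (2 * √y) / (2 * √Real.pi * y ^ (3 / 4 : ℝ)) / √y := by positivity
  linarith

/-! ### The subexponential profile and its insensitivity to shifts -/

/-- The subexponential profile `e^{c √k} k^{-3/4}`. -/
noncomputable def sqrtExpProfile (c k : ℝ) : ℝ := Real.exp (c * √k) * k ^ (-(3 / 4) : ℝ)

theorem sqrtExpProfile_pos (c : ℝ) {k : ℝ} (hk : 0 < k) : 0 < sqrtExpProfile c k := by
  unfold sqrtExpProfile; positivity

theorem sqrtExpProfile_eq_exp (c : ℝ) {k : ℝ} (hk : 0 < k) :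
    sqrtExpProfile c k = Real.exp (c * √k - 3 / 4 * Real.log k) := by
  rw [sqrtExpProfile, Real.rpow_def_of_pos hk, ← Real.exp_add]; ring_nf

theorem abs_sqrt_sub_sqrt_le {k y : ℝ} (hk : 0 < k) (hy : 0 ≤ y) :
    |√y - √k| ≤ |y - k| / √k := by
  have hs : 0 < √k := Real.sqrt_pos.2 hk
  rw [le_div_iff₀ hs]
  have h : y - k = (√y - √k) * (√y + √k) := by
    ring_nf; rw [Real.sq_sqrt hy, Real.sq_sqrt hk.le]
  rw [h, abs_mul, abs_of_nonneg (by positivity : 0 ≤ √y + √k)]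
  gcongr
  linarith [Real.sqrt_nonneg y]

/-- Apply `log x ≤ x - 1` to both `y / k` and `k / y`; the factor `2` comes from `y ≥ k / 2`. The
bound is weakened from `1 / k` to `1 / √k` to match the one for square roots. -/
theorem abs_log_sub_log_le {k y : ℝ} (hk : 1 ≤ k) (hy : k / 2 ≤ y) :
    |Real.log y - Real.log k| ≤ 2 * (|y - k| / √k) := by
  have hk0 : 0 < k := by linarith
  have hy0 : 0 < y := by linarith
  have hsk : √k ≤ k := Real.sqrt_le_iff.2 ⟨hk0.le, by nlinarith⟩
  have hs : 0 < √k := Real.sqrt_pos.2 hk0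
  have h1 : |y - k| / k ≤ |y - k| / √k := by gcongr
  have h3 : 0 ≤ |y - k| / k := by positivity
  have h2 : Real.log y - Real.log k ≤ |y - k| / k := by
    rw [← Real.log_div hy0.ne' hk0.ne']
    refine (Real.log_le_sub_one_of_pos (by positivity)).trans ?_
    rw [show y / k - 1 = (y - k) / k by field_simp]
    gcongr; exact le_abs_self _
  have h4 : Real.log k - Real.log y ≤ 2 * (|y - k| / k) := by
    rw [← Real.log_div hk0.ne' hy0.ne']
    refine (Real.log_le_sub_one_of_pos (by positivity)).trans ?_
    rw [show k / y - 1 = -(y - k) / y by field_simp; ring]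
    calc -(y - k) / y ≤ |y - k| / (k / 2) := by
          gcongr; exact neg_le_abs _
      _ = _ := by field_simp
  rw [abs_le]; constructor <;> linarith

theorem abs_exp_sub_one_le_mul_exp (x : ℝ) : |Real.exp x - 1| ≤ |x| * Real.exp |x| := by
  rcases le_total 0 x with h | h
  · rw [abs_of_nonneg h, abs_of_nonneg (by linarith [Real.one_le_exp h])]
    have := Real.add_one_le_exp (-x)
    have h2 : Real.exp (-x) * Real.exp x = 1 := by rw [← Real.exp_add]; simp
    nlinarith [Real.exp_pos x]
  · have h1 := Real.add_one_le_exp x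
    have h2 := Real.exp_le_one_iff.2 h
    have h3 := Real.one_le_exp (abs_nonneg x)
    rw [abs_of_nonpos (by linarith : Real.exp x - 1 ≤ 0)]
    rw [abs_of_nonpos h] at *
    nlinarith

/-- Moving the argument of the profile by at most half changes it by a relative error
`O(|y - k| / √k)`, up to an exponential factor. -/
theorem abs_sqrtExpProfile_sub_le {c k y : ℝ} (hc : 0 ≤ c) (hk : 1 ≤ k) (hy : k / 2 ≤ y) :
    |sqrtExpProfile c y - sqrtExpProfile c k| ≤ sqrtExpProfile c k *
      ((c + 3 / 2) * (|y - k| / √k) * Real.exp ((c + 3 / 2) * (|y - k| / √k))) := by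
  have hk0 : 0 < k := by linarith
  have hy0 : 0 < y := by linarith
  have h1 := abs_sqrt_sub_sqrt_le hk0 hy0.le
  have h2 := abs_log_sub_log_le hk hy
  set d := |y - k| / √k
  have hd : 0 ≤ d := by positivity
  -- `x` is the logarithm of the ratio of the two profiles; in its bound, `3/2` is `3/4` times the
  -- `2` of the logarithm estimate.
  set x := c * (√y - √k) - 3 / 4 * (Real.log y - Real.log k) with hx
  have hxd : |x| ≤ (c + 3 / 2) * d := by
    refine (abs_sub _ _).trans ?_
    rw [abs_mul, abs_mul, abs_of_nonneg hc, abs_of_nonneg (by norm_num : (0 : ℝ) ≤ 3 / 4)]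
    nlinarith
  have he : sqrtExpProfile c y - sqrtExpProfile c k = sqrtExpProfile c k * (Real.exp x - 1) := by
    rw [mul_sub, mul_one, sqrtExpProfile_eq_exp c hk0, sqrtExpProfile_eq_exp c hy0, ← Real.exp_add,
      hx]
    ring_nf
  rw [he, abs_mul, abs_of_pos (sqrtExpProfile_pos c hk0)]
  refine mul_le_mul_of_nonneg_left ((abs_exp_sub_one_le_mul_exp x).trans ?_)
    (sqrtExpProfile_pos c hk0).le
  gcongr

theorem le_exp_mul_div {δ x : ℝ} (hδ : 0 < δ) : x ≤ Real.exp (δ * x) / δ := by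
  rw [le_div_iff₀ hδ]; linarith [Real.add_one_le_exp (δ * x)]

/-- Half of the exponent `δ x` absorbs `x²` through the quadratic term of the exponential, and the
other half absorbs `c √x` by completing the square. -/
theorem sq_mul_exp_sqrt_le {c δ x : ℝ} (hδ : 0 < δ) (hx : 0 ≤ x) :
    x ^ 2 * Real.exp (c * √x) ≤ 8 / δ ^ 2 * Real.exp (c ^ 2 / (2 * δ)) * Real.exp (δ * x) := by
  have h1 : x ^ 2 ≤ 8 / δ ^ 2 * Real.exp (δ / 2 * x) := by
    have := Real.quadratic_le_exp_of_nonneg (x := δ / 2 * x) (by positivity)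
    rw [div_mul_eq_mul_div, le_div_iff₀ (by positivity)]
    nlinarith [mul_nonneg hδ.le hx]
  have h2 : c * √x ≤ c ^ 2 / (2 * δ) + δ / 2 * x := by
    have hs := Real.sq_sqrt hx
    have : c ^ 2 / (2 * δ) + δ / 2 * x - c * √x = (c - δ * √x) ^ 2 / (2 * δ) := by
      nth_rewrite 1 [← hs]; field_simp; ring
    have h3 : 0 ≤ (c - δ * √x) ^ 2 / (2 * δ) := by positivity
    linarith
  calc x ^ 2 * Real.exp (c * √x) ≤ (8 / δ ^ 2 * Real.exp (δ / 2 * x)) *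
        Real.exp (c ^ 2 / (2 * δ) + δ / 2 * x) := by gcongr
    _ = 8 / δ ^ 2 * Real.exp (c ^ 2 / (2 * δ)) *
        (Real.exp (δ / 2 * x) * Real.exp (δ / 2 * x)) := by rw [Real.exp_add]; ring
    _ = _ := by rw [← Real.exp_add]; ring_nf

/-- For shifts larger than half of the argument the exponential weight dominates. -/
theorem exp_sqrt_add_le_of_lt_abs {c δ k u : ℝ} (hc : 0 ≤ c) (hδ : 0 < δ) (hk : 1 ≤ k)
    (hu : k / 2 < |u|) :
    Real.exp (c * √(k + u)) ≤ 4 * (8 / δ ^ 2 * Real.exp (c ^ 2 / (2 * δ))) *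
      (sqrtExpProfile c k / √k) * Real.exp (δ * |u|) := by
  have hk0 : 0 < k := by linarith
  have hs : 0 < √k := Real.sqrt_pos.2 hk0
  have hu0 : 0 ≤ |u| := abs_nonneg u
  have hsk : √k ≤ k := Real.sqrt_le_iff.2 ⟨hk0.le, by nlinarith⟩
  have hfs : 0 < sqrtExpProfile c k / √k := div_pos (sqrtExpProfile_pos c hk0) hs
  have t1 : √(k + u) ≤ √k + √|u| := by
    refine Real.sqrt_le_iff.2 ⟨by positivity, ?_⟩
    rw [add_sq, Real.sq_sqrt hk0.le, Real.sq_sqrt hu0]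
    have : 0 ≤ 2 * √k * √|u| := by positivity
    linarith [le_abs_self u]
  have t2 : Real.exp (c * √(k + u)) ≤ Real.exp (c * √k) * Real.exp (c * √|u|) := by
    rw [← Real.exp_add, ← mul_add]
    exact Real.exp_le_exp.2 (mul_le_mul_of_nonneg_left t1 hc)
  -- The polynomial factor separating `e^{c√k}` from the target is paid for by powers of `|u|`, as
  -- `k < 2|u|`.
  have q : k ^ (3 / 4 : ℝ) * √k ≤ 4 * |u| ^ 2 := by
    have q1 : k ^ (3 / 4 : ℝ) ≤ k := by
      simpa using Real.rpow_le_rpow_of_exponent_le hk (by norm_num : (3 / 4 : ℝ) ≤ 1)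
    calc k ^ (3 / 4 : ℝ) * √k ≤ (2 * |u|) * (2 * |u|) := by
          refine mul_le_mul ?_ ?_ hs.le (by positivity) <;> linarith
      _ = _ := by ring
  have e : Real.exp (c * √k) = sqrtExpProfile c k / √k * (k ^ (3 / 4 : ℝ) * √k) := by
    rw [sqrtExpProfile, Real.rpow_neg hk0.le]; field_simp
  rw [e] at t2
  have t4 := sq_mul_exp_sqrt_le (c := c) hδ hu0
  refine t2.trans ?_
  generalize sqrtExpProfile c k / √k = F at *
  have hG0 := Real.exp_pos (c * √|u|)
  generalize Real.exp (c * √|u|) = G at *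
  calc F * (k ^ (3 / 4 : ℝ) * √k) * G ≤ F * (4 * |u| ^ 2) * G := by
        refine mul_le_mul_of_nonneg_right (mul_le_mul_of_nonneg_left q hfs.le) hG0.le
    _ = 4 * F * (|u| ^ 2 * G) := by ring
    _ ≤ 4 * F * _ := mul_le_mul_of_nonneg_left t4 (by positivity)
    _ = _ := by ring

/-- A function asymptotic to a multiple of the profile is, uniformly in the shift `u` and up to
the weight `e^{δ|u|}`, within a relative `O(k^{-1/2})` of the unshifted profile. -/
theorem exists_abs_shift_sub_le {D : ℝ → ℝ} {c κ K δ : ℝ} (hc : 0 ≤ c) (hκ : 0 ≤ κ) (hK : 0 ≤ K)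
    (hδ : 0 < δ) (h0 : ∀ y ≤ 0, D y = 0) (h1 : ∀ y, 0 < y → |D y| ≤ K * Real.exp (c * √y))
    (h2 : ∀ y, 0 < y → |D y - κ * sqrtExpProfile c y| ≤ K * (sqrtExpProfile c y / √y)) :
    ∃ K' k₀ : ℝ, 0 < K' ∧ 1 ≤ k₀ ∧ ∀ k, k₀ ≤ k → ∀ u,
      |D (k + u) - κ * sqrtExpProfile c k| ≤
        K' * (sqrtExpProfile c k / √k) * Real.exp (δ * |u|) := by
  set C := c + 3 / 2
  have hC : 0 < C := by positivity
  set M := 8 / δ ^ 2 * Real.exp (c ^ 2 / (2 * δ)) with hM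
  -- The first two terms serve shifts `|u| ≤ k / 2`, the next two serve larger shifts, and the final
  -- `1` ensures positivity. The threshold `k₀` forces `C / √k ≤ δ / 2`, so the exponential loss
  -- stays within `e^{δ|u|/2}`.
  refine ⟨2 * K + κ * (C * (2 / δ)) + 4 * K * M + κ * (2 / δ) + 1, 1 + (2 * C / δ) ^ 2,
    by positivity, by nlinarith [sq_nonneg (2 * C / δ)], fun k hk u => ?_⟩
  have hk1 : 1 ≤ k := by nlinarith [sq_nonneg (2 * C / δ)]
  have hk0 : 0 < k := by linarith
  have hs : 0 < √k := Real.sqrt_pos.2 hk0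
  have hf := sqrtExpProfile_pos c hk0
  have hfs : 0 < sqrtExpProfile c k / √k := by positivity
  have hE : 0 < Real.exp (δ * |u|) := Real.exp_pos _
  have hsk : √k ≤ k := Real.sqrt_le_iff.2 ⟨hk0.le, by nlinarith⟩
  have hCs : C / √k ≤ δ / 2 := by
    have : 2 * C / δ ≤ √k := Real.le_sqrt_of_sq_le (by linarith)
    rw [div_le_iff₀ hδ] at this
    rw [div_le_iff₀ hs]; linarith
  set F := sqrtExpProfile c k / √k with hF
  have hFk : sqrtExpProfile c k = F * √k := by rw [hF]; field_simp
  set E := Real.exp (δ * |u|)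
  have hA1 : 0 ≤ 2 * K * F * E := by positivity
  have hA2 : 0 ≤ κ * (C * (2 / δ)) * F * E := by positivity
  have hA3 : 0 ≤ 4 * K * M * F * E := by positivity
  have hA4 : 0 ≤ κ * (2 / δ) * F * E := by positivity
  have hA5 : 0 ≤ F * E := by positivity
  -- For small shifts the profile is compared with itself at `k`. For large shifts no cancellation
  -- is used: each term is separately dominated by the weight.
  rcases le_or_gt |u| (k / 2) with hu | hu
  · have hy : k / 2 ≤ k + u := by linarith [neg_abs_le u]
    have hy0 : 0 < k + u := by linarith
    have hb := abs_sqrtExpProfile_sub_le hc hk1 hy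
    rw [add_sub_cancel_left] at hb
    set ε := C * (|u| / √k) with hε
    have hε0 : 0 ≤ ε := by positivity
    have hε1 : ε ≤ δ / 2 * |u| := by
      calc ε = C / √k * |u| := by rw [hε]; ring
        _ ≤ _ := by gcongr
    have hεE : ε * Real.exp ε ≤ C * (2 / δ) / √k * E := by
      calc ε * Real.exp ε ≤ (C / √k * (Real.exp (δ / 2 * |u|) / (δ / 2))) *
            Real.exp (δ / 2 * |u|) := by
            gcongr
            calc ε = C / √k * |u| := by rw [hε]; ring
              _ ≤ _ := by gcongr; exact le_exp_mul_div (by positivity)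
        _ = C * (2 / δ) / √k * (Real.exp (δ / 2 * |u|) * Real.exp (δ / 2 * |u|)) := by
            field_simp
        _ = _ := by rw [← Real.exp_add]; congr 2; ring
    have hfy : sqrtExpProfile c (k + u) ≤ sqrtExpProfile c k * E := by
      have hy' := sqrtExpProfile_eq_exp c hy0
      have hk' := sqrtExpProfile_eq_exp c hk0
      have a1 := abs_sqrt_sub_sqrt_le hk0 hy0.le
      have a2 := abs_log_sub_log_le hk1 hy
      rw [add_sub_cancel_left] at a1 a2
      rw [hy', hk', ← Real.exp_add]
      refine Real.exp_le_exp.2 ?_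
      have b1 := mul_le_mul_of_nonneg_left ((le_abs_self _).trans a1) hc
      have b2 := (neg_abs_le _).trans' (neg_le_neg a2)
      have b3 : ε = c * (|u| / √k) + 3 / 2 * (|u| / √k) := by rw [hε]; ring
      nlinarith [mul_nonneg hδ.le (abs_nonneg u)]
    have hsy : 1 / √(k + u) ≤ 2 / √k := by
      rw [div_le_div_iff₀ (Real.sqrt_pos.2 hy0) hs, one_mul]
      refine Real.sqrt_le_iff.2 ⟨by positivity, ?_⟩
      rw [mul_pow, Real.sq_sqrt hy0.le]; linarith
    have hD := h2 _ hy0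
    have hD' : K * (sqrtExpProfile c (k + u) / √(k + u)) ≤ 2 * K * F * E := by
      calc K * (sqrtExpProfile c (k + u) / √(k + u))
          = K * (sqrtExpProfile c (k + u) * (1 / √(k + u))) := by ring
        _ ≤ K * (sqrtExpProfile c k * E * (2 / √k)) := by gcongr
        _ = _ := by rw [hF]; ring
    have hκ' : |κ * sqrtExpProfile c (k + u) - κ * sqrtExpProfile c k| ≤
        κ * (C * (2 / δ)) * F * E := by
      rw [← mul_sub, abs_mul, abs_of_nonneg hκ]
      calc _ ≤ κ * (sqrtExpProfile c k * (C * (2 / δ) / √k * E)) := by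
            gcongr; exact hb.trans (by gcongr)
        _ = _ := by rw [hF]; ring
    have hfin := abs_sub_le (D (k + u)) (κ * sqrtExpProfile c (k + u)) (κ * sqrtExpProfile c k)
    refine hfin.trans ?_
    rw [add_mul, add_mul, add_mul, add_mul, add_mul, add_mul, add_mul, add_mul]
    linarith
  · have hu0 : 0 ≤ |u| := abs_nonneg u
    have hDb : |D (k + u)| ≤ 4 * K * M * F * E := by
      rcases le_or_gt (k + u) 0 with hn | hp
      · rw [h0 _ hn, abs_zero]; exact hA3
      · refine (h1 _ hp).trans ?_
        calc K * Real.exp (c * √(k + u)) ≤ K * (4 * M * F * E) :=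
              mul_le_mul_of_nonneg_left (exp_sqrt_add_le_of_lt_abs hc hδ hk1 hu) hK
          _ = _ := by ring
    have hκb : |κ * sqrtExpProfile c k| ≤ κ * (2 / δ) * F * E := by
      rw [abs_of_nonneg (by positivity), hFk]
      have : √k ≤ 2 / δ * E := by
        have := le_exp_mul_div (x := |u|) hδ
        calc √k ≤ 2 * |u| := by linarith
          _ ≤ 2 * (E / δ) := by gcongr
          _ = _ := by ring
      calc κ * (F * √k) ≤ κ * (F * (2 / δ * E)) := by gcongr
        _ = _ := by ring
    have hfin := abs_sub (D (k + u)) (κ * sqrtExpProfile c k)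
    refine hfin.trans ?_
    rw [add_mul, add_mul, add_mul, add_mul, add_mul, add_mul, add_mul, add_mul]
    linarith

/-! ### Compound Poisson sums of exponentials: density and transforms -/

theorem integrableOn_pow_mul_exp_neg_mul (n : ℕ) {ρ : ℝ} (hρ : 0 < ρ) :
    IntegrableOn (fun x : ℝ => x ^ n * Real.exp (-(ρ * x))) (Set.Ioi 0) := by
  simpa [Real.rpow_natCast] using
    integrableOn_rpow_mul_exp_neg_mul (s := n) (by linarith [n.cast_nonneg (α := ℝ)]) hρ

theorem integral_pow_mul_exp_neg_mul (n : ℕ) {ρ : ℝ} (hρ : 0 < ρ) :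
    ∫ x in Set.Ioi (0 : ℝ), x ^ n * Real.exp (-(ρ * x)) = n.factorial / ρ ^ (n + 1) := by
  have h := Real.integral_rpow_mul_exp_neg_mul_Ioi (a := n + 1) (by positivity) hρ
  rw [Real.Gamma_nat_eq_factorial, add_sub_cancel_right] at h
  simp only [Real.rpow_natCast] at h
  rw [h, ← Nat.cast_add_one, Real.rpow_natCast, div_pow, one_pow]
  field_simp

theorem norm_pow_mul_cexp (n : ℕ) (s : ℂ) {x : ℝ} (hx : 0 ≤ x) :
    ‖(x : ℂ) ^ n * Complex.exp (-(s * x))‖ = x ^ n * Real.exp (-(s.re * x)) := by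
  rw [norm_mul, norm_pow, Complex.norm_of_nonneg hx, Complex.norm_exp]
  simp

theorem integrableOn_pow_mul_cexp (n : ℕ) {s : ℂ} (hs : 0 < s.re) :
    IntegrableOn (fun x : ℝ => (x : ℂ) ^ n * Complex.exp (-(s * x))) (Set.Ioi 0) := by
  refine Integrable.mono' (integrableOn_pow_mul_exp_neg_mul n hs)
    (Continuous.aestronglyMeasurable (by fun_prop))
    ((ae_restrict_iff' measurableSet_Ioi).2 (Eventually.of_forall fun x hx => ?_))
  exact (norm_pow_mul_cexp n s (le_of_lt hx)).le

/-- Induction through integration by parts. Complex `s` is needed because laws are later identified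
by characteristic functions. -/
theorem integral_pow_mul_cexp (n : ℕ) {s : ℂ} (hs : 0 < s.re) :
    ∫ x in Set.Ioi (0 : ℝ), (x : ℂ) ^ n * Complex.exp (-(s * x)) = n.factorial / s ^ (n + 1) := by
  have hs0 : s ≠ 0 := fun h => by simp [h] at hs
  induction n with
  | zero =>
    have h := integral_exp_mul_complex_Ioi (a := -s) (by simpa using hs) 0
    simp only [neg_mul] at h
    simp only [pow_zero, one_mul, h]
    simp
  | succ n ih =>
    have hi := integrableOn_pow_mul_cexp (n + 1) hs
    have hi' := (integrableOn_pow_mul_cexp n hs).const_mul (((n : ℂ) + 1) / s)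
    have h := integral_Ioi_of_hasDerivAt_of_tendsto' (a := (0 : ℝ)) (m := 0)
      (f := fun x : ℝ => -((x : ℂ) ^ (n + 1) * Complex.exp (-(s * x))) / s)
      (f' := fun x : ℝ => (x : ℂ) ^ (n + 1) * Complex.exp (-(s * x)) -
        ((n : ℂ) + 1) / s * ((x : ℂ) ^ n * Complex.exp (-(s * x)))) ?_ (hi.sub hi') ?_
    · rw [integral_sub hi hi', integral_const_mul, ih] at h
      simp only [Complex.ofReal_zero, zero_pow (Nat.succ_ne_zero n), zero_mul, neg_zero, zero_div,
        sub_zero] at h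
      rw [sub_eq_zero] at h
      rw [h, Nat.factorial_succ]
      push_cast
      field_simp
      ring
    · intro x _
      have d0 : HasDerivAt (fun x : ℝ => (x : ℂ)) 1 x := Complex.ofRealCLM.hasDerivAt
      have d1 := d0.pow (n + 1)
      have d2 := ((d0.const_mul s).neg).cexp
      refine ((d1.mul d2).neg.div_const s).congr_deriv ?_
      simp only [Pi.pow_apply, Pi.neg_apply, Nat.add_sub_cancel]
      push_cast
      field_simp
      ring
    · rw [tendsto_zero_iff_norm_tendsto_zero]
      have ht := (tendsto_rpow_mul_exp_neg_mul_atTop_nhds_zero (n + 1) s.re hs).div_const ‖s‖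
      rw [zero_div] at ht
      refine ht.congr' ?_
      filter_upwards [eventually_ge_atTop 0] with x hx
      rw [norm_div, norm_neg, norm_pow_mul_cexp _ _ hx, ← Nat.cast_add_one, Real.rpow_natCast,
        neg_mul]

theorem hasSum_besselSeries (y : ℝ) :
    HasSum (fun m : ℕ => y ^ m / ((m.factorial : ℝ) * ((m + 1).factorial : ℝ)))
      (besselSeries y) := (summable_besselSeries y).hasSum

/-- The density on `(0, ∞)` of a compound Poisson sum with exponential jumps, up to the factor
`e^{-a}`; here `A` is the product of the Poisson parameter and the exponential rate `r`. -/
noncomputable def compoundExpDensity (A r x : ℝ) : ℝ :=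
  A * besselSeries (A * x) * Real.exp (-(r * x))

theorem continuous_compoundExpDensity (A r : ℝ) : Continuous (compoundExpDensity A r) := by
  have := continuous_besselSeries
  unfold compoundExpDensity
  fun_prop

theorem compoundExpDensity_nonneg {A x : ℝ} (hA : 0 ≤ A) (r : ℝ) (hx : 0 ≤ x) :
    0 ≤ compoundExpDensity A r x := by
  have := besselSeries_nonneg (mul_nonneg hA hx)
  unfold compoundExpDensity
  positivity

theorem hasSum_exp_sub_one (w : ℂ) :
    HasSum (fun m : ℕ => w ^ (m + 1) / (m + 1).factorial) (Complex.exp w - 1) := by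
  have h := NormedSpace.expSeries_div_hasSum_exp w
  rw [← Complex.exp_eq_exp_ℂ] at h
  simpa using (hasSum_nat_add_iff' 1).2 h

section Transform
variable {A r : ℝ} {z : ℂ}

/-- Integrate termwise: the `m`-th term is the Erlang contribution of `m + 1` jumps, and its gamma
integral cancels `m!`. Absolute convergence is the same computation with `z` replaced by its real
part. -/
theorem hasSum_integral_compoundExpDensity (hA : 0 ≤ A) (hz : z.re < r) :
    HasSum (fun m : ℕ => (A / (r - z)) ^ (m + 1) / (m + 1).factorial)
      (∫ x in Set.Ioi (0 : ℝ), (compoundExpDensity A r x : ℂ) * Complex.exp (z * x)) := by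
  have hs : 0 < ((r : ℂ) - z).re := by simpa using hz
  have hs0 : (r : ℂ) - z ≠ 0 := fun h => by simp [h] at hs
  set c : ℕ → ℝ := fun m => A ^ (m + 1) / ((m.factorial : ℝ) * ((m + 1).factorial : ℝ)) with hc
  have hc0 (m : ℕ) : 0 ≤ c m := by positivity
  have h := hasSum_integral_of_summable_integral_norm (μ := volume.restrict (Set.Ioi (0 : ℝ)))
    (F := fun (m : ℕ) (x : ℝ) => (c m : ℂ) * ((x : ℂ) ^ m * Complex.exp (-((r - z) * x))))
    (fun m => (integrableOn_pow_mul_cexp m hs).const_mul _) ?_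
  · convert! h using 1
    · ext m
      rw [integral_const_mul, integral_pow_mul_cexp m hs, hc]
      have h0 : (m.factorial : ℂ) ≠ 0 := by exact_mod_cast m.factorial_ne_zero
      rw [div_pow]
      push_cast
      field_simp
    · refine integral_congr_ae (Eventually.of_forall fun x => ?_)
      have hx := (hasSum_besselSeries (A * x)).mul_left (A * Real.exp (-(r * x)))
      have hx' := (Complex.hasSum_ofReal.2 hx).mul_right (Complex.exp (z * x))
      have e1 : ((A * Real.exp (-(r * x)) * besselSeries (A * x) : ℝ) : ℂ) =
          (compoundExpDensity A r x : ℂ) := by rw [compoundExpDensity]; congr 1; ring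
      rw [e1] at hx'
      dsimp only
      rw [← hx'.tsum_eq]
      congr 1
      ext m
      rw [show -((r - z) * (x : ℂ)) = -(r * x) + z * x by ring, Complex.exp_add, hc]
      push_cast
      ring
  · refine (Real.summable_pow_div_factorial (A / (r - z.re))).comp_injective
      (add_left_injective 1) |>.congr fun m => ?_
    have e : ∫ x in Set.Ioi (0 : ℝ), ‖(c m : ℂ) * ((x : ℂ) ^ m * Complex.exp (-((r - z) * x)))‖ =
        ∫ x in Set.Ioi (0 : ℝ), c m * (x ^ m * Real.exp (-((r - z.re) * x))) := by
      refine setIntegral_congr_fun measurableSet_Ioi fun x hx => ?_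
      rw [norm_mul, Complex.norm_of_nonneg (hc0 m), norm_pow_mul_cexp _ _ (le_of_lt hx)]
      simp
    rw [e, integral_const_mul, integral_pow_mul_exp_neg_mul m (by linarith), hc]
    simp only [Function.comp_apply, div_pow]
    field_simp

theorem integral_compoundExpDensity (hA : 0 ≤ A) (hz : z.re < r) :
    ∫ x in Set.Ioi (0 : ℝ), (compoundExpDensity A r x : ℂ) * Complex.exp (z * x) =
      Complex.exp (A / (r - z)) - 1 :=
  (hasSum_integral_compoundExpDensity hA hz).unique (hasSum_exp_sub_one _)

theorem integrableOn_compoundExpDensity_mul_exp (hA : 0 ≤ A) {s : ℝ} (hs : s < r) :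
    IntegrableOn (fun x => compoundExpDensity A r x * Real.exp (s * x)) (Set.Ioi 0) := by
  set ε := (r - s) / 2 with hε
  have hε0 : 0 < ε := by rw [hε]; linarith
  have hi := (integrableOn_pow_mul_exp_neg_mul 0 hε0).const_mul (A * Real.exp (A / ε))
  have hcont := continuous_compoundExpDensity A r
  refine Integrable.mono' hi (Continuous.aestronglyMeasurable (by fun_prop))
    ((ae_restrict_iff' measurableSet_Ioi).2 (Eventually.of_forall fun x hx => ?_))
  have hx0 : 0 ≤ x := le_of_lt hx
  have hAx := mul_nonneg hA hx0
  rw [Real.norm_of_nonneg (mul_nonneg (compoundExpDensity_nonneg hA r hx0) (Real.exp_pos _).le),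
    compoundExpDensity, pow_zero, one_mul]
  -- Half of the gap `r - s` is spent on the Bessel growth; the other half remains as the decay
  -- `e^{-εx}`.
  have h1 : 2 * √(A * x) ≤ A / ε + ε * x := by
    rw [Real.sqrt_mul hA]
    have e : A / ε + ε * x - 2 * (√A * √x) = (√A - ε * √x) ^ 2 / ε := by
      nth_rewrite 1 [← Real.sq_sqrt hA, ← Real.sq_sqrt hx0]; field_simp; ring
    have : 0 ≤ (√A - ε * √x) ^ 2 / ε := by positivity
    linarith
  calc A * besselSeries (A * x) * Real.exp (-(r * x)) * Real.exp (s * x)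
      ≤ A * Real.exp (A / ε + ε * x) * Real.exp (-(r * x)) * Real.exp (s * x) := by
        gcongr
        exact (besselSeries_le_exp hAx).trans (Real.exp_le_exp.2 h1)
    _ = A * Real.exp (A / ε) * Real.exp (-(ε * x)) := by
        rw [mul_assoc, mul_assoc, mul_assoc, ← Real.exp_add, ← Real.exp_add, ← Real.exp_add]
        congr 2
        rw [hε]; ring

theorem integrableOn_compoundExpDensity_mul_cexp (hA : 0 ≤ A) (hz : z.re < r) :
    IntegrableOn (fun x : ℝ => (compoundExpDensity A r x : ℂ) * Complex.exp (z * x))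
      (Set.Ioi 0) := by
  have hcont := continuous_compoundExpDensity A r
  refine Integrable.mono' (integrableOn_compoundExpDensity_mul_exp hA hz)
    (Continuous.aestronglyMeasurable (by fun_prop))
    ((ae_restrict_iff' measurableSet_Ioi).2 (Eventually.of_forall fun x hx => ?_))
  rw [norm_mul, Complex.norm_of_nonneg (compoundExpDensity_nonneg hA r (le_of_lt hx)),
    Complex.norm_exp]
  simp

end Transform

/-- The compound Poisson law with Poisson parameter `a` and exponential jumps of rate `r`. -/
noncomputable def compoundExpLaw (a r : ℝ) : Measure ℝ :=
  ENNReal.ofReal (Real.exp (-a)) • (Measure.dirac 0 + (volume.restrict (Set.Ioi 0)).withDensity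
    fun x => ENNReal.ofReal (compoundExpDensity (a * r) r x))

section Law
variable {a r : ℝ} {z : ℂ}

theorem lintegral_compoundExpLaw (a r : ℝ) {f : ℝ → ENNReal} (hf : Measurable f) :
    ∫⁻ x, f x ∂(compoundExpLaw a r) = ENNReal.ofReal (Real.exp (-a)) * (f 0 +
      ∫⁻ x in Set.Ioi 0, ENNReal.ofReal (compoundExpDensity (a * r) r x) * f x) := by
  have hm := (continuous_compoundExpDensity (a * r) r).measurable.ennreal_ofReal
  rw [compoundExpLaw, lintegral_smul_measure, lintegral_add_measure, lintegral_dirac' 0 hf,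
    lintegral_withDensity_eq_lintegral_mul _ hm hf]
  rfl

theorem integrable_cexp_withDensity_compoundExpDensity {A : ℝ} (hA : 0 ≤ A) (hz : z.re < r) :
    Integrable (fun x : ℝ => Complex.exp (z * x)) ((volume.restrict (Set.Ioi 0)).withDensity
      fun x => ENNReal.ofReal (compoundExpDensity A r x)) := by
  have hm := (continuous_compoundExpDensity A r).measurable
  rw [integrable_withDensity_iff_integrable_smul₀' hm.ennreal_ofReal.aemeasurable
    (Eventually.of_forall fun x => ENNReal.ofReal_lt_top)]
  refine (integrableOn_compoundExpDensity_mul_cexp hA hz).congr_fun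
    (fun x hx => ?_) measurableSet_Ioi
  dsimp only
  rw [ENNReal.toReal_ofReal (compoundExpDensity_nonneg hA r (le_of_lt hx))]
  simp

theorem integrable_cexp_compoundExpLaw (ha : 0 ≤ a) (hr : 0 ≤ r) (hz : z.re < r) :
    Integrable (fun x : ℝ => Complex.exp (z * x)) (compoundExpLaw a r) :=
  ((integrable_dirac (by simp)).add_measure
    (integrable_cexp_withDensity_compoundExpDensity (mul_nonneg ha hr) hz)).smul_measure
    ENNReal.ofReal_ne_top

/-- The atom at `0`, the event of no jumps, supplies exactly the `1` missing from the transform of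
the density. -/
theorem integral_cexp_compoundExpLaw (ha : 0 ≤ a) (hr : 0 ≤ r) (hz : z.re < r) :
    ∫ x : ℝ, Complex.exp (z * x) ∂(compoundExpLaw a r) =
      Complex.exp (a * (r / (r - z)) - a) := by
  have hm := (continuous_compoundExpDensity (a * r) r).measurable
  have hA := mul_nonneg ha hr
  have hd := integrable_cexp_withDensity_compoundExpDensity (z := z) hA hz
  rw [compoundExpLaw, integral_smul_measure, integral_add_measure (integrable_dirac (by simp)) hd,
    integral_dirac, integral_withDensity_eq_integral_toReal_smul₀ hm.ennreal_ofReal.aemeasurable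
      (Eventually.of_forall fun x => ENNReal.ofReal_lt_top)]
  have e : ∫ x in Set.Ioi (0 : ℝ),
      (ENNReal.ofReal (compoundExpDensity (a * r) r x)).toReal • Complex.exp (z * x) =
      ∫ x in Set.Ioi (0 : ℝ), (compoundExpDensity (a * r) r x : ℂ) * Complex.exp (z * x) := by
    refine setIntegral_congr_fun measurableSet_Ioi fun x hx => ?_
    rw [ENNReal.toReal_ofReal (compoundExpDensity_nonneg hA r (le_of_lt hx))]
    simp
  rw [e, integral_compoundExpDensity hA hz, ENNReal.toReal_ofReal (Real.exp_pos _).le]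
  rw [show (a : ℂ) * (r / (r - z)) - a = ((-a : ℝ) : ℂ) + ((a * r : ℝ) : ℂ) / (r - z) by
    push_cast; ring, Complex.exp_add, ← Complex.ofReal_exp]
  simp

theorem isProbabilityMeasure_compoundExpLaw (ha : 0 ≤ a) (hr : 0 < r) :
    IsProbabilityMeasure (compoundExpLaw a r) := by
  have hi := integrable_cexp_compoundExpLaw (z := 0) ha hr.le (by simpa using hr)
  have h := integral_cexp_compoundExpLaw (z := 0) ha hr.le (by simpa using hr)
  have hr0 : (r : ℂ) ≠ 0 := by exact_mod_cast hr.ne'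
  simp only [zero_mul, Complex.exp_zero] at hi
  have : IsFiniteMeasure (compoundExpLaw a r) := by
    simpa using (integrable_const_iff.1 hi)
  simp [hr0] at h
  refine ⟨?_⟩
  have h' : (compoundExpLaw a r).real Set.univ = 1 := by exact_mod_cast h
  rwa [measureReal_def, ENNReal.toReal_eq_one_iff] at h'

theorem charFun_compoundExpLaw (ha : 0 ≤ a) (hr : 0 < r) (t : ℝ) :
    charFun (compoundExpLaw a r) t = Complex.exp (a * (r / (r - t * Complex.I)) - a) := by
  rw [← integral_cexp_compoundExpLaw ha hr.le (by simpa using hr), charFun_apply_real]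
  congr 1; ext x; congr 1; ring

theorem integrable_exp_compoundExpLaw (ha : 0 ≤ a) (hr : 0 ≤ r) {s : ℝ} (hs : s < r) :
    Integrable (fun x : ℝ => Real.exp (s * x)) (compoundExpLaw a r) := by
  refine (integrable_cexp_compoundExpLaw (z := s) ha hr (by simpa using hs)).norm.congr
    (Eventually.of_forall fun x => ?_)
  simp [Complex.norm_exp]

theorem integral_exp_compoundExpLaw (ha : 0 ≤ a) (hr : 0 ≤ r) {s : ℝ} (hs : s < r) :
    ∫ x : ℝ, Real.exp (s * x) ∂(compoundExpLaw a r) = Real.exp (a * (r / (r - s)) - a) := by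
  have h := integral_cexp_compoundExpLaw (z := s) ha hr (by simpa using hs)
  have e : ∫ x : ℝ, Complex.exp ((s : ℂ) * x) ∂(compoundExpLaw a r) =
      ((∫ x : ℝ, Real.exp (s * x) ∂(compoundExpLaw a r) : ℝ) : ℂ) := by
    rw [← integral_complex_ofReal]; simp
  rw [e] at h
  exact_mod_cast h

end Law

/-! ### The law of the log-return -/

theorem kouDensity_nonneg {lamPlus lamMinus p : ℝ} (hlamPlus : 0 < lamPlus)
    (hlamMinus : 0 < lamMinus) (hp0 : 0 < p) (hp1 : p < 1) (y : ℝ) :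
    0 ≤ kouDensity lamPlus lamMinus p y := by
  have : 0 < 1 - p := by linarith
  exact add_nonneg (Set.indicator_nonneg (fun _ _ => by positivity) _)
    (Set.indicator_nonneg (fun _ _ => by positivity) _)

theorem measurable_kouDensity (lamPlus lamMinus p : ℝ) :
    Measurable (kouDensity lamPlus lamMinus p) := by
  unfold kouDensity
  exact (Measurable.indicator (by fun_prop) measurableSet_Ici).add
    (Measurable.indicator (by fun_prop) measurableSet_Iio)

/-- The mixture form is what splits the compound Poisson exponent into positive and negative jumps.
-/
theorem charFun_kouJumpLaw {lamPlus lamMinus p : ℝ} (hlamPlus : 0 < lamPlus)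
    (hlamMinus : 0 < lamMinus) (hp0 : 0 < p) (hp1 : p < 1) (t : ℝ) :
    charFun (kouJumpLaw lamPlus lamMinus p) t =
      p * (lamPlus / (lamPlus - t * Complex.I)) +
        (1 - p) * (lamMinus / (lamMinus + t * Complex.I)) := by
  have hm := measurable_kouDensity lamPlus lamMinus p
  set w : ℂ := t * Complex.I with hw
  have hwre : w.re = 0 := by simp [hw]
  have r1 : (w - lamPlus).re < 0 := by simp [hwre, hlamPlus]
  have r2 : 0 < (w + lamMinus).re := by simp [hwre, hlamMinus]
  have n1 : (w - lamPlus : ℂ) ≠ 0 := fun h => by simp [h] at r1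
  have n2 : (w + lamMinus : ℂ) ≠ 0 := fun h => by simp [h] at r2
  have n1' : (lamPlus - w : ℂ) ≠ 0 := by rw [← neg_sub]; exact neg_ne_zero.2 n1
  rw [charFun_apply_real, kouJumpLaw, integral_withDensity_eq_integral_toReal_smul₀
    hm.ennreal_ofReal.aemeasurable (Eventually.of_forall fun x => ENNReal.ofReal_lt_top)]
  have e : (fun x : ℝ => (ENNReal.ofReal (kouDensity lamPlus lamMinus p x)).toReal •
      Complex.exp (t * x * Complex.I)) = fun x : ℝ =>
      (Set.Ici (0 : ℝ)).indicator
        (fun x : ℝ => (p * lamPlus : ℂ) * Complex.exp ((w - lamPlus) * x)) x +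
      (Set.Iio (0 : ℝ)).indicator
        (fun x : ℝ => ((1 - p) * lamMinus : ℂ) * Complex.exp ((w + lamMinus) * x)) x := by
    ext x
    rw [ENNReal.toReal_ofReal (kouDensity_nonneg hlamPlus hlamMinus hp0 hp1 x), kouDensity]
    rcases le_or_gt 0 x with h | h
    · rw [Set.indicator_of_mem (Set.mem_Ici.2 h), Set.indicator_of_notMem (by simpa using h),
        Set.indicator_of_mem (Set.mem_Ici.2 h), Set.indicator_of_notMem (by simpa using h),
        show (w - lamPlus) * x = -(lamPlus * x : ℂ) + t * x * Complex.I by rw [hw]; ring,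
        Complex.exp_add, Complex.real_smul]
      push_cast
      ring_nf
    · rw [Set.indicator_of_notMem (by simpa using h), Set.indicator_of_mem (Set.mem_Iio.2 h),
        Set.indicator_of_notMem (by simpa using h), Set.indicator_of_mem (Set.mem_Iio.2 h),
        show (w + lamMinus) * x = (lamMinus * x : ℂ) + t * x * Complex.I by rw [hw]; ring,
        Complex.exp_add, Complex.real_smul]
      push_cast
      ring_nf
  have i1 : IntegrableOn (fun x : ℝ => (p * lamPlus : ℂ) * Complex.exp ((w - lamPlus) * x))
      (Set.Ici 0) := by
    rw [integrableOn_Ici_iff_integrableOn_Ioi]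
    exact (integrableOn_exp_mul_complex_Ioi r1 0).const_mul _
  have i2 : IntegrableOn (fun x : ℝ => ((1 - p) * lamMinus : ℂ) * Complex.exp ((w + lamMinus) * x))
      (Set.Iio 0) :=
    ((integrableOn_exp_mul_complex_Iic r2 0).mono_set Set.Iio_subset_Iic_self).const_mul _
  rw [e, integral_add (i1.integrable_indicator measurableSet_Ici)
    (i2.integrable_indicator measurableSet_Iio), integral_indicator measurableSet_Ici,
    integral_indicator measurableSet_Iio, integral_Ici_eq_integral_Ioi,
    ← integral_Iic_eq_integral_Iio, integral_const_mul, integral_const_mul,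
    integral_exp_mul_complex_Ioi r1, integral_exp_mul_complex_Iic r2]
  have n2' : (lamMinus + w : ℂ) ≠ 0 := by rwa [add_comm]
  simp only [Complex.ofReal_zero, mul_zero, Complex.exp_zero]
  rw [show (w - lamPlus : ℂ) = -(lamPlus - w) by ring, add_comm w]
  field_simp

section Model
variable {Ω : Type*} [MeasurableSpace Ω] {P : Measure Ω}

theorem IsPoissonProcess.map_eq {N : ℝ≥0 → Ω → ℕ} {r : ℝ≥0} (h : IsPoissonProcess N r P)
    (t : ℝ≥0) : P.map (N t) = poissonMeasure (r * t) := by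
  have hl := (h.law_increment 0 t zero_le).congr (Y := fun ω => (N t ω : ℝ)) (by
    filter_upwards [h.zero] with ω hω
    simp [hω])
  rw [tsub_zero] at hl
  have hc : Measurable (fun n : ℕ => (n : ℝ)) := .of_discrete
  -- The increment law concerns real-valued casts; taking floors recovers the law on `ℕ`.
  have h1 := congrArg (Measure.map Nat.floor) hl.map_eq
  have e : Nat.floor ∘ (fun n : ℕ => (n : ℝ)) = id := by ext n; simp
  rw [Measure.map_map Nat.measurable_floor (show Measurable fun ω => (N t ω : ℝ) from
    hc.comp (h.measurable t)),
    Measure.map_map Nat.measurable_floor hc, e, Measure.map_id] at h1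
  rw [← h1]
  congr 1
  ext ω
  simp

/-- The characteristic function of a Poisson number of i.i.d. summands. -/
theorem charFun_map_sum_range [IsProbabilityMeasure P] {M : Ω → ℕ} {Y : ℕ → Ω → ℝ} {r : ℝ≥0}
    {μ : Measure ℝ} (hM : Measurable M) (hMlaw : P.map M = poissonMeasure r)
    (hY : ∀ j, Measurable (Y j)) (hYlaw : ∀ j, P.map (Y j) = μ) (hYi : iIndepFun Y P)
    (hMY : IndepFun M (fun ω j => Y j ω) P) (t : ℝ) :
    charFun (P.map fun ω => ∑ j ∈ Finset.range (M ω), Y j ω) t =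
      Complex.exp (r * (charFun μ t - 1)) := by
  have hYm : Measurable fun ω j => Y j ω := measurable_pi_lambda _ hY
  have hS : Measurable fun q : ℕ × (ℕ → ℝ) => ∑ j ∈ Finset.range q.1, q.2 j :=
    measurable_from_prod_countable_right fun n => by
      dsimp only; fun_prop
  have hmap : P.map (fun ω => ∑ j ∈ Finset.range (M ω), Y j ω) =
      ((poissonMeasure r).prod (P.map fun ω j => Y j ω)).map
        fun q : ℕ × (ℕ → ℝ) => ∑ j ∈ Finset.range q.1, q.2 j := by
    rw [← hMlaw, ← (indepFun_iff_map_prod_eq_prod_map_map hM.aemeasurable hYm.aemeasurable).1 hMY,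
      Measure.map_map hS (hM.prodMk hYm)]
    rfl
  have : IsProbabilityMeasure (P.map fun ω j => Y j ω) :=
    Measure.isProbabilityMeasure_map hYm.aemeasurable
  have hF : Measurable fun q : ℕ × (ℕ → ℝ) =>
      Complex.exp (t * (∑ j ∈ Finset.range q.1, q.2 j : ℝ) * Complex.I) := by fun_prop
  have hFi : Integrable (fun q : ℕ × (ℕ → ℝ) =>
      Complex.exp (t * (∑ j ∈ Finset.range q.1, q.2 j : ℝ) * Complex.I))
      ((poissonMeasure r).prod (P.map fun ω j => Y j ω)) := by
    refine Integrable.of_bound hF.aestronglyMeasurable 1 (Eventually.of_forall fun q => ?_)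
    rw [← Complex.ofReal_mul, Complex.norm_exp_ofReal_mul_I]
  -- Given the count `n`, independence gives the `n`-th power; summing over `n` is then the Poisson
  -- generating function.
  have hin (n : ℕ) : ∫ y, Complex.exp (t * (∑ j ∈ Finset.range n, y j : ℝ) * Complex.I)
      ∂(P.map fun ω j => Y j ω) = charFun μ t ^ n := by
    rw [integral_map hYm.aemeasurable (Measurable.aestronglyMeasurable (by fun_prop))]
    have h1 := iIndepFun.charFun_map_fun_finsetSum_eq_prod (s := Finset.range n) (X := Y)
      (fun i _ => (hY i).aemeasurable) (hYi.restrict _)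
    have h2 := congrFun h1 t
    rw [charFun_apply_real, integral_map (Measurable.aemeasurable (by fun_prop))
      (by fun_prop)] at h2
    rw [h2]
    simp [hYlaw]
  rw [charFun_apply_real, hmap, integral_map hS.aemeasurable (by fun_prop), integral_prod _ hFi]
  simp only [hin]
  rw [integral_poissonMeasure]
  have h3 := (NormedSpace.expSeries_div_hasSum_exp (r * charFun μ t)).mul_left
    ((Real.exp (-r) : ℝ) : ℂ)
  rw [← Complex.exp_eq_exp_ℂ] at h3
  have h4 : ∀ n : ℕ, (Real.exp (-r) * (r : ℝ) ^ n / n.factorial) • charFun μ t ^ n =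
      ((Real.exp (-r) : ℝ) : ℂ) * ((r * charFun μ t) ^ n / n.factorial) := fun n => by
    rw [Complex.real_smul]; push_cast; ring
  simp only [h4]
  rw [h3.tsum_eq, mul_sub, mul_one, sub_eq_neg_add, Complex.exp_add]
  push_cast
  rfl

/-- The law of the diffusion part plus the negative jumps at time `T`; `a` is the expected number
of negative jumps. -/
noncomputable def diffusiveLaw (b σ T a lamMinus : ℝ) : Measure ℝ :=
  gaussianReal (b * T) (σ ^ 2 * T).toNNReal ∗ (compoundExpLaw a lamMinus).map (-1 * ·)

theorem isProbabilityMeasure_diffusiveLaw (b σ T : ℝ) {a lamMinus : ℝ} (ha : 0 ≤ a)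
    (hlamMinus : 0 < lamMinus) : IsProbabilityMeasure (diffusiveLaw b σ T a lamMinus) := by
  have := isProbabilityMeasure_compoundExpLaw ha hlamMinus
  have : IsProbabilityMeasure ((compoundExpLaw a lamMinus).map (-1 * ·)) :=
    Measure.isProbabilityMeasure_map (by fun_prop)
  unfold diffusiveLaw
  infer_instance

variable {W : ℝ≥0 → Ω → ℝ} {N : ℝ≥0 → Ω → ℕ} {Y : ℕ → Ω → ℝ} {lam : ℝ≥0}
  {lamPlus lamMinus p : ℝ}

theorem IsKouModel.measurable_logReturn (h : IsKouModel P W N Y lam lamPlus lamMinus p)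
    (b σ : ℝ) (T : ℝ≥0) : Measurable (logReturn b σ W N Y T) := by
  have hS : Measurable fun q : ℕ × (ℕ → ℝ) => ∑ j ∈ Finset.range q.1, q.2 j :=
    measurable_from_prod_countable_right fun n => by
      dsimp only; fun_prop
  have h1 := h.measurable_W T
  have h2 : Measurable fun ω => ∑ j ∈ Finset.range (N T ω), Y j ω :=
    hS.comp ((h.poisson.measurable T).prodMk (measurable_pi_lambda _ h.measurable_Y))
  unfold logReturn
  fun_prop

/-- The log-return is distributed as the sum of independent diffusive and negative-jump parts
and a compound Poisson sum of exponential jumps. -/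
theorem IsKouModel.map_logReturn [IsProbabilityMeasure P]
    (h : IsKouModel P W N Y lam lamPlus lamMinus p) (b σ : ℝ) (T : ℝ≥0)
    (hlamPlus : 0 < lamPlus) (hlamMinus : 0 < lamMinus) (hp0 : 0 < p) (hp1 : p < 1) :
    P.map (logReturn b σ W N Y T) =
      diffusiveLaw b σ T (lam * T * (1 - p)) lamMinus ∗ compoundExpLaw (lam * T * p) lamPlus := by
  have ha : 0 ≤ (lam * T * p : ℝ) := by positivity
  have ha' : 0 ≤ (lam * T * (1 - p) : ℝ) := mul_nonneg (by positivity) (by linarith)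
  have := isProbabilityMeasure_diffusiveLaw b σ T ha' hlamMinus
  have := isProbabilityMeasure_compoundExpLaw ha hlamPlus
  have := isProbabilityMeasure_compoundExpLaw ha' hlamMinus
  have : IsProbabilityMeasure
      ((compoundExpLaw (lam * T * (1 - p)) lamMinus).map (-1 * ·)) :=
    Measure.isProbabilityMeasure_map (by fun_prop)
  have hS : Measurable fun q : ℕ × (ℕ → ℝ) => ∑ j ∈ Finset.range q.1, q.2 j :=
    measurable_from_prod_countable_right fun n => by
      dsimp only; fun_prop
  have hNY : Measurable fun q : (ℝ≥0 → ℕ) × (ℕ → ℝ) => ∑ j ∈ Finset.range (q.1 T), q.2 j :=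
    hS.comp (show Measurable fun q : (ℝ≥0 → ℕ) × (ℕ → ℝ) => (q.1 T, q.2) by fun_prop)
  have hW := h.measurable_W T
  have hJ : Measurable fun ω => ∑ j ∈ Finset.range (N T ω), Y j ω :=
    hS.comp ((h.poisson.measurable T).prodMk (measurable_pi_lambda _ h.measurable_Y))
  have hind : IndepFun (fun ω => b * (T : ℝ) + σ * W T ω)
      (fun ω => ∑ j ∈ Finset.range (N T ω), Y j ω) P :=
    h.indep_W.comp (φ := fun f : ℝ≥0 → ℝ => b * (T : ℝ) + σ * f T)
      (by fun_prop) hNY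
  have hlawW := (h.brownian.toIsPreBrownianReal.hasLaw_eval T).map_eq
  have hNi : IndepFun (N T) (fun ω j => Y j ω) P :=
    h.indep_N_Y.comp (φ := fun f : ℝ≥0 → ℕ => f T) (measurable_pi_apply T) measurable_id
  have : IsProbabilityMeasure (P.map (logReturn b σ W N Y T)) :=
    Measure.isProbabilityMeasure_map (h.measurable_logReturn b σ T).aemeasurable
  refine Measure.ext_of_charFun ?_
  ext t
  have e1 := congrFun (hind.charFun_map_fun_add_eq_mul (by fun_prop) hJ.aemeasurable) t
  have e2 := charFun_map_sum_range (h.poisson.measurable T) (h.poisson.map_eq T) h.measurable_Y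
    (fun j => (h.law_Y j).map_eq) h.indep_Y hNi t
  have e3 : charFun (P.map fun ω => b * (T : ℝ) + σ * W T ω) t =
      charFun (gaussianReal (b * T) (σ ^ 2 * T).toNNReal) t := by
    have hm : P.map (fun ω => b * (T : ℝ) + σ * W T ω) =
        ((P.map (W T)).map (σ * ·)).map (b * T + ·) := by
      rw [Measure.map_map (by fun_prop) hW, Measure.map_map (by fun_prop) (by fun_prop)]
      rfl
    rw [hm, hlawW, charFun_map_const_add, charFun_map_mul, charFun_gaussianReal,
      charFun_gaussianReal, ← Complex.exp_add]
    congr 1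
    rw [Real.coe_toNNReal _ (by positivity)]
    simp
    ring
  have e4 : P.map (logReturn b σ W N Y T) = P.map (fun ω => (b * (T : ℝ) + σ * W T ω) +
      ∑ j ∈ Finset.range (N T ω), Y j ω) := rfl
  -- Poisson thinning: writing `1 = p + (1 - p)` divides the exponent `λT(φ - 1)` into the exponents
  -- of the two one-sided compound laws.
  rw [e4, e1, Pi.mul_apply, e2, e3, charFun_kouJumpLaw hlamPlus hlamMinus hp0 hp1, diffusiveLaw,
    charFun_conv, charFun_conv, charFun_map_mul, charFun_compoundExpLaw ha hlamPlus,
    charFun_compoundExpLaw ha' hlamMinus, mul_assoc, ← Complex.exp_add]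
  congr 2
  push_cast
  ring_nf

end Model

/-! ### Exponential moments of the diffusive part -/

theorem integrable_exp_conv {μ ν : Measure ℝ} [SFinite μ] [SFinite ν] {s : ℝ}
    (hμ : Integrable (fun x => Real.exp (s * x)) μ)
    (hν : Integrable (fun x => Real.exp (s * x)) ν) :
    Integrable (fun x => Real.exp (s * x)) (μ ∗ ν) := by
  rw [Measure.conv, integrable_map_measure (by fun_prop) (by fun_prop)]
  refine (hμ.mul_prod hν).congr (Eventually.of_forall fun q => ?_)
  simp [mul_add, Real.exp_add]

theorem integral_exp_conv (μ ν : Measure ℝ) [SFinite μ] [SFinite ν] (s : ℝ) :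
    ∫ x, Real.exp (s * x) ∂(μ ∗ ν) =
      (∫ x, Real.exp (s * x) ∂μ) * ∫ x, Real.exp (s * x) ∂ν := by
  rw [Measure.conv, integral_map (by fun_prop) (by fun_prop), ← integral_prod_mul]
  simp [mul_add, Real.exp_add]

section DiffusiveLaw
variable {b σ T a lamMinus s : ℝ}

theorem integrable_exp_map_neg_compoundExpLaw (ha : 0 ≤ a) (hl : 0 < lamMinus)
    (hs : -lamMinus < s) :
    Integrable (fun x => Real.exp (s * x)) ((compoundExpLaw a lamMinus).map (-1 * ·)) := by
  rw [integrable_map_measure (by fun_prop) (by fun_prop)]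
  refine (integrable_exp_compoundExpLaw ha hl.le (s := -s) (by linarith)).congr
    (Eventually.of_forall fun x => ?_)
  simp

theorem integrable_exp_diffusiveLaw (ha : 0 ≤ a) (hl : 0 < lamMinus) (hs : -lamMinus < s) :
    Integrable (fun x => Real.exp (s * x)) (diffusiveLaw b σ T a lamMinus) := by
  have := isProbabilityMeasure_compoundExpLaw ha hl
  have : IsProbabilityMeasure ((compoundExpLaw a lamMinus).map (-1 * ·)) :=
    Measure.isProbabilityMeasure_map (by fun_prop)
  exact integrable_exp_conv (integrable_exp_mul_gaussianReal s)
    (integrable_exp_map_neg_compoundExpLaw ha hl hs)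

theorem integral_exp_diffusiveLaw (hT : 0 ≤ T) (ha : 0 ≤ a) (hl : 0 < lamMinus)
    (hs : -lamMinus < s) :
    ∫ x, Real.exp (s * x) ∂(diffusiveLaw b σ T a lamMinus) =
      Real.exp (b * T * s + σ ^ 2 * T * s ^ 2 / 2 + (a * (lamMinus / (lamMinus + s)) - a)) := by
  have := isProbabilityMeasure_compoundExpLaw ha hl
  have : IsProbabilityMeasure ((compoundExpLaw a lamMinus).map (-1 * ·)) :=
    Measure.isProbabilityMeasure_map (by fun_prop)
  have h1 : ∫ x, Real.exp (s * x) ∂(gaussianReal (b * T) (σ ^ 2 * T).toNNReal) =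
      Real.exp (b * T * s + σ ^ 2 * T * s ^ 2 / 2) := by
    have := congrFun (mgf_id_gaussianReal (μ := b * T) (v := (σ ^ 2 * T).toNNReal)) s
    rw [Real.coe_toNNReal _ (by positivity)] at this
    exact this
  have h2 : ∫ x, Real.exp (s * x) ∂((compoundExpLaw a lamMinus).map (-1 * ·)) =
      Real.exp (a * (lamMinus / (lamMinus + s)) - a) := by
    rw [integral_map (by fun_prop) (by fun_prop)]
    have := integral_exp_compoundExpLaw ha hl.le (s := -s) (by linarith)
    rw [sub_neg_eq_add] at this
    rw [← this]
    simp
  rw [diffusiveLaw, integral_exp_conv, h1, h2, ← Real.exp_add]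

end DiffusiveLaw

/-! ### The tilted density and the call payoff -/

/-- The exponentially tilted density of the compound Poisson sum, extended by zero. -/
noncomputable def tiltedDensity (A : ℝ) : ℝ → ℝ :=
  (Set.Ioi (0 : ℝ)).indicator fun y => A * besselSeries (A * y)

theorem measurable_tiltedDensity (A : ℝ) : Measurable (tiltedDensity A) := by
  have := continuous_besselSeries
  exact Measurable.indicator (Continuous.measurable (by fun_prop)) measurableSet_Ioi

theorem tiltedDensity_nonneg {A : ℝ} (hA : 0 ≤ A) (y : ℝ) : 0 ≤ tiltedDensity A y :=
  Set.indicator_nonneg (fun _ hy =>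
    mul_nonneg hA (besselSeries_nonneg (mul_nonneg hA (le_of_lt hy)))) y

theorem exists_abs_tiltedDensity_shift_sub_le {A δ : ℝ} (hA : 0 < A) (hδ : 0 < δ) :
    ∃ K k₀ : ℝ, 0 < K ∧ 1 ≤ k₀ ∧ ∀ k, k₀ ≤ k → ∀ u,
      |tiltedDensity A (k + u) -
          A ^ (1 / 4 : ℝ) / (2 * √Real.pi) * sqrtExpProfile (2 * √A) k| ≤
        K * (sqrtExpProfile (2 * √A) k / √k) * Real.exp (δ * |u|) := by
  set κ := A ^ (1 / 4 : ℝ) / (2 * √Real.pi) with hκ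
  have hκ0 : 0 < κ := by positivity
  have hsA : 0 < √A := Real.sqrt_pos.2 hA
  -- In `K`, the term `A` covers the crude growth bound and `κ / √A` the Bessel error, because `1 /
  -- √(A y) = (1 / √A) / √y`.
  refine exists_abs_shift_sub_le (K := A + κ / √A) (by positivity) hκ0.le (by positivity) hδ
    (fun y hy => Set.indicator_of_notMem (by simpa using hy) _) (fun y hy => ?_) fun y hy => ?_
  · have hAy : 0 < A * y := by positivity
    rw [abs_of_nonneg (tiltedDensity_nonneg hA.le y), tiltedDensity,
      Set.indicator_of_mem (Set.mem_Ioi.2 hy), mul_assoc 2, ← Real.sqrt_mul hA.le]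
    have h1 := besselSeries_le_exp hAy.le
    have h2 : 0 ≤ κ / √A := by positivity
    exact mul_le_mul (by linarith) h1 (besselSeries_nonneg hAy.le) (by positivity)
  · have hAy : 0 < A * y := by positivity
    have hsy : 0 < √y := Real.sqrt_pos.2 hy
    have hf := sqrtExpProfile_pos (2 * √A) hy
    have h := abs_besselSeries_sub_le hAy
    have e : A * (Real.exp (2 * √(A * y)) / (2 * √Real.pi * (A * y) ^ (3 / 4 : ℝ))) =
        κ * sqrtExpProfile (2 * √A) y := by
      have hA4 : A ^ (1 / 4 : ℝ) * A ^ (3 / 4 : ℝ) = A := by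
        rw [← Real.rpow_add hA]; norm_num
      have hq : A ^ (3 / 4 : ℝ) ≠ 0 := by positivity
      rw [hκ, sqrtExpProfile, Real.mul_rpow hA.le hy.le, Real.sqrt_mul hA.le, Real.rpow_neg hy.le]
      nth_rewrite 1 [← hA4]
      field_simp
    rw [tiltedDensity, Set.indicator_of_mem (Set.mem_Ioi.2 hy), ← e, ← mul_sub, abs_mul,
      abs_of_pos hA]
    calc A * |besselSeries (A * y) - _| ≤ A * _ := mul_le_mul_of_nonneg_left h hA.le
      _ = κ / √A * (sqrtExpProfile (2 * √A) y / √y) := by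
          rw [← mul_div_assoc, e, Real.sqrt_mul hA.le]; field_simp
      _ ≤ _ := by gcongr; linarith

/-- The weight `(e^w - 1) e^{-r w}` produced by the call payoff. -/
noncomputable def payoffWeight (r w : ℝ) : ℝ := (Real.exp w - 1) * Real.exp (-(r * w))

theorem payoffWeight_nonneg (r : ℝ) {w : ℝ} (hw : 0 ≤ w) : 0 ≤ payoffWeight r w :=
  mul_nonneg (by linarith [Real.one_le_exp hw]) (Real.exp_pos _).le

theorem payoffWeight_eq (r w : ℝ) :
    payoffWeight r w = Real.exp ((1 - r) * w) - Real.exp (-r * w) := by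
  rw [payoffWeight, sub_mul, ← Real.exp_add]; ring_nf

theorem integrableOn_payoffWeight {r : ℝ} (hr : 1 < r) :
    IntegrableOn (payoffWeight r) (Set.Ioi 0) := by
  refine Integrable.congr ((integrableOn_exp_mul_Ioi (by linarith : 1 - r < 0) 0).sub
    (integrableOn_exp_mul_Ioi (by linarith : -r < 0) 0)) (Eventually.of_forall fun w => ?_)
  simp [payoffWeight_eq]

theorem integral_payoffWeight {r : ℝ} (hr : 1 < r) :
    ∫ w in Set.Ioi (0 : ℝ), payoffWeight r w = 1 / (r * (r - 1)) := by
  simp only [payoffWeight_eq]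
  have h1 : (1 - r) ≠ 0 := by linarith
  have h2 : (r - 1) ≠ 0 := by linarith
  have h3 : r ≠ 0 := by linarith
  rw [integral_sub (integrableOn_exp_mul_Ioi (by linarith : 1 - r < 0) 0)
    (integrableOn_exp_mul_Ioi (by linarith : -r < 0) 0), integral_exp_mul_Ioi (by linarith),
    integral_exp_mul_Ioi (by linarith), show (1 - r) = -(r - 1) by ring]
  simp only [mul_zero, Real.exp_zero]
  field_simp
  ring

/-- The shift weight `e^{δw}` is absorbed by lowering the rate, which is harmless while `r - δ > 1`.
-/
theorem payoffWeight_mul_exp (r δ w : ℝ) :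
    payoffWeight r w * Real.exp (δ * w) = payoffWeight (r - δ) w := by
  rw [payoffWeight, mul_assoc, ← Real.exp_add, payoffWeight]; ring_nf

/-- The call payoff as a function of the log-return and the log-strike. -/
noncomputable def callPayoff (k x : ℝ) : ℝ := max (Real.exp x - Real.exp k) 0

theorem measurable_callPayoff (k : ℝ) : Measurable (callPayoff k) := by
  unfold callPayoff; fun_prop

theorem callPayoff_nonneg (k x : ℝ) : 0 ≤ callPayoff k x := le_max_right _ _

/-- A Chernoff bound: where the payoff is positive, `s (x - k) ≥ 0`. Taking `s = 0` gives finiteness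
of the price, and `s = r` makes the atom negligible. -/
theorem callPayoff_le_exp (k x : ℝ) {s : ℝ} (hs : 0 ≤ s) :
    callPayoff k x ≤ Real.exp (-(s * k)) * Real.exp ((1 + s) * x) := by
  rw [← Real.exp_add]
  refine max_le ?_ (Real.exp_pos _).le
  rcases le_total x k with h | h
  · have := Real.exp_le_exp.2 h
    linarith [Real.exp_pos (-(s * k) + (1 + s) * x)]
  · refine (sub_le_self _ (Real.exp_pos k).le).trans (Real.exp_le_exp.2 ?_)
    nlinarith

/-- Substitute `v = w + (k - z)`, so that `w` is the log-moneyness. The payoff vanishes for `w ≤ 0`,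
while the constraint `v > 0` is carried by the extension of `tiltedDensity` by zero. -/
theorem lintegral_compoundExpDensity_mul_callPayoff {a r : ℝ} (ha : 0 ≤ a) (hr : 0 ≤ r)
    (k z : ℝ) :
    ∫⁻ v in Set.Ioi 0, ENNReal.ofReal (compoundExpDensity (a * r) r v) *
        ENNReal.ofReal (callPayoff k (z + v)) =
      ENNReal.ofReal (Real.exp (-((r - 1) * k))) * ∫⁻ w in Set.Ioi 0, ENNReal.ofReal
        (Real.exp (r * z) * payoffWeight r w * tiltedDensity (a * r) (k + (w - z))) := by
  have hA := mul_nonneg ha hr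
  have hm : Measurable fun w => ENNReal.ofReal
      (Real.exp (r * z) * payoffWeight r w * tiltedDensity (a * r) (k + (w - z))) := by
    have := measurable_tiltedDensity (a * r)
    unfold payoffWeight
    fun_prop
  rw [← lintegral_const_mul _ hm, ← lintegral_indicator measurableSet_Ioi,
    ← lintegral_indicator measurableSet_Ioi, ← lintegral_add_right_eq_self _ (k - z)]
  congr 1
  ext w
  rcases le_or_gt (w + (k - z)) 0 with hv | hv
  · have ht : tiltedDensity (a * r) (k + (w - z)) = 0 :=
      Set.indicator_of_notMem (by simp only [Set.mem_Ioi, not_lt]; linarith) _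
    rw [Set.indicator_of_notMem (by simpa using hv), Set.indicator_apply, ht]
    simp
  rw [Set.indicator_of_mem (Set.mem_Ioi.2 hv)]
  rcases le_or_gt w 0 with hw | hw
  · rw [Set.indicator_of_notMem (by simpa using hw), callPayoff, max_eq_right]
    · simp
    · rw [sub_nonpos]; exact Real.exp_le_exp.2 (by linarith)
  · rw [Set.indicator_of_mem (Set.mem_Ioi.2 hw), ← ENNReal.ofReal_mul
      (compoundExpDensity_nonneg hA r hv.le), ← ENNReal.ofReal_mul (Real.exp_pos _).le,
      tiltedDensity, Set.indicator_of_mem (Set.mem_Ioi.2 (by linarith)), callPayoff, max_eq_left,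
      compoundExpDensity, payoffWeight]
    · congr 1
      rw [show w + (k - z) = k + (w - z) by ring, show z + (k + (w - z)) = k + w by ring,
        show -(r * (k + (w - z))) = -((r - 1) * k) - k + r * z + -(r * w) by ring, Real.exp_add,
        Real.exp_add, Real.exp_sub, Real.exp_add k w]
      have := (Real.exp_pos k).ne'
      field_simp
    · rw [sub_nonneg]; exact Real.exp_le_exp.2 (by linarith)

/-! ### Asymptotics of the price for an independent sum -/

section Tail
variable {ζ : Measure ℝ} {a r : ℝ}

theorem lintegral_callPayoff_conv (ha : 0 ≤ a) (hr : 0 < r) (k : ℝ) :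
    ∫⁻ x, ENNReal.ofReal (callPayoff k x) ∂(ζ ∗ compoundExpLaw a r) =
      ENNReal.ofReal (Real.exp (-a)) * (∫⁻ z, ENNReal.ofReal (callPayoff k z) ∂ζ +
        ENNReal.ofReal (Real.exp (-((r - 1) * k))) *
          ∫⁻ q, ENNReal.ofReal
            (Real.exp (r * q.1) * payoffWeight r q.2 * tiltedDensity (a * r) (k + (q.2 - q.1)))
            ∂(ζ.prod (volume.restrict (Set.Ioi 0)))) := by
  have := isProbabilityMeasure_compoundExpLaw ha hr
  have hp := measurable_callPayoff k
  have hm : Measurable fun q : ℝ × ℝ => ENNReal.ofReal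
      (Real.exp (r * q.1) * payoffWeight r q.2 * tiltedDensity (a * r) (k + (q.2 - q.1))) := by
    have := measurable_tiltedDensity (a * r)
    unfold payoffWeight
    fun_prop
  rw [Measure.lintegral_conv (by fun_prop)]
  have h1 (z : ℝ) := lintegral_compoundExpLaw a r (f := fun v => ENNReal.ofReal
    (callPayoff k (z + v))) (by fun_prop)
  simp only [h1, add_zero, lintegral_compoundExpDensity_mul_callPayoff ha hr.le]
  rw [lintegral_const_mul', lintegral_add_left (by fun_prop), lintegral_const_mul',
    lintegral_prod _ hm.aemeasurable]
  all_goals exact ENNReal.ofReal_ne_top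

theorem integrable_exp_mul_payoffWeight (hr : 1 < r) {s : ℝ}
    (hζ : Integrable (fun z => Real.exp (s * z)) ζ) :
    Integrable (fun q : ℝ × ℝ => Real.exp (s * q.1) * payoffWeight r q.2)
      (ζ.prod (volume.restrict (Set.Ioi 0))) :=
  hζ.mul_prod (integrableOn_payoffWeight hr)

/-- The tilted price integral is asymptotic to the profile times the total mass of the weight. -/
theorem exists_abs_integral_tiltedDensity_sub_le [IsProbabilityMeasure ζ]
    (ha : 0 < a) (hr : 1 < r)
    (hζ : ∀ s, 0 ≤ s → Integrable (fun z => Real.exp (s * z)) ζ) :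
    ∃ K k₀ : ℝ, 0 < K ∧ 1 ≤ k₀ ∧ ∀ k, k₀ ≤ k →
      Integrable (fun q : ℝ × ℝ => Real.exp (r * q.1) * payoffWeight r q.2 *
        tiltedDensity (a * r) (k + (q.2 - q.1))) (ζ.prod (volume.restrict (Set.Ioi 0))) ∧
      |(∫ q : ℝ × ℝ, Real.exp (r * q.1) * payoffWeight r q.2 *
          tiltedDensity (a * r) (k + (q.2 - q.1)) ∂(ζ.prod (volume.restrict (Set.Ioi 0)))) -
        (a * r) ^ (1 / 4 : ℝ) / (2 * √Real.pi) * sqrtExpProfile (2 * √(a * r)) k *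
          ((∫ z, Real.exp (r * z) ∂ζ) * (1 / (r * (r - 1))))| ≤
        K * (sqrtExpProfile (2 * √(a * r)) k / √k) := by
  -- This choice keeps `r - δ > 1`, so the payoff weight stays integrable after absorbing `e^{δw}`.
  set δ := (r - 1) / 2 with hδ
  have hδ0 : 0 < δ := by rw [hδ]; linarith
  have hA : 0 < a * r := mul_pos ha (by linarith)
  obtain ⟨K, k₀, hK, hk₀, hb⟩ := exists_abs_tiltedDensity_shift_sub_le hA hδ0
  set π := ζ.prod (volume.restrict (Set.Ioi (0 : ℝ))) with hπ
  set κ := (a * r) ^ (1 / 4 : ℝ) / (2 * √Real.pi)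
  have hm0 := integrable_exp_mul_payoffWeight hr (hζ r (by linarith))
  have hm1 := integrable_exp_mul_payoffWeight (r := r - δ) (by rw [hδ]; linarith)
    (hζ (r + δ) (by linarith))
  have hm2 := integrable_exp_mul_payoffWeight (r := r - δ) (by rw [hδ]; linarith)
    (hζ (r - δ) (by rw [hδ]; linarith))
  have hpos : ∀ᵐ q ∂π, 0 < q.2 := by
    have h1 : ∀ᵐ w ∂(volume.restrict (Set.Ioi (0 : ℝ))), 0 < w :=
      ae_restrict_mem measurableSet_Ioi
    exact Measure.quasiMeasurePreserving_snd.ae h1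
  -- `G` dominates the weight times `e^{δ|w - z|}`, using `e^{δ|w - z|} ≤ e^{δw} (e^{δz} + e^{-δz})`
  -- for `w > 0`.
  set G : ℝ × ℝ → ℝ := fun q => (Real.exp ((r + δ) * q.1) * payoffWeight (r - δ) q.2) +
    (Real.exp ((r - δ) * q.1) * payoffWeight (r - δ) q.2) with hG
  have hGi : Integrable G π := hm1.add hm2
  have hG0 : 0 ≤ ∫ q, G q ∂π := by
    refine integral_nonneg_of_ae ?_
    filter_upwards [hpos] with q hq
    have := payoffWeight_nonneg (r - δ) hq.le
    simp only [hG, Pi.zero_apply]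
    positivity
  refine ⟨K * (∫ q, G q ∂π + 1), k₀, by positivity, hk₀, fun k hk => ?_⟩
  have hk0 : 0 < k := by linarith
  have hF : 0 < sqrtExpProfile (2 * √(a * r)) k / √k :=
    div_pos (sqrtExpProfile_pos _ hk0) (Real.sqrt_pos.2 hk0)
  set F := sqrtExpProfile (2 * √(a * r)) k / √k
  set H : ℝ × ℝ → ℝ := fun q => Real.exp (r * q.1) * payoffWeight r q.2 *
    tiltedDensity (a * r) (k + (q.2 - q.1))
  set m : ℝ × ℝ → ℝ := fun q => Real.exp (r * q.1) * payoffWeight r q.2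
  have hH : Measurable H := by
    have := measurable_tiltedDensity (a * r)
    unfold H payoffWeight
    fun_prop
  have hbd : ∀ᵐ q ∂π, ‖H q - κ * sqrtExpProfile (2 * √(a * r)) k * m q‖ ≤ K * F * G q := by
    filter_upwards [hpos] with q hq
    have hw := payoffWeight_nonneg r hq.le
    have hw' := payoffWeight_nonneg (r - δ) hq.le
    have h1 := hb k hk (q.2 - q.1)
    have h2 : Real.exp (δ * |q.2 - q.1|) ≤
        Real.exp (δ * q.2) * (Real.exp (δ * q.1) + Real.exp (-(δ * q.1))) := by
      rw [mul_add, ← Real.exp_add, ← Real.exp_add]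
      rcases abs_cases q.1 with ⟨h, h'⟩ | ⟨h, h'⟩
      · refine le_add_of_le_of_nonneg (Real.exp_le_exp.2 ?_) (Real.exp_pos _).le
        rw [← mul_add]
        refine mul_le_mul_of_nonneg_left ?_ hδ0.le
        rw [abs_le]; constructor <;> linarith
      · refine le_add_of_nonneg_of_le (Real.exp_pos _).le (Real.exp_le_exp.2 ?_)
        rw [← sub_eq_add_neg, ← mul_sub]
        refine mul_le_mul_of_nonneg_left ?_ hδ0.le
        rw [abs_le]; constructor <;> linarith
    have h3 : H q - κ * sqrtExpProfile (2 * √(a * r)) k * m q =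
        m q * (tiltedDensity (a * r) (k + (q.2 - q.1)) -
          κ * sqrtExpProfile (2 * √(a * r)) k) := by simp only [H, m]; ring
    have hm' : 0 ≤ m q := mul_nonneg (Real.exp_pos _).le hw
    rw [h3, norm_mul, Real.norm_of_nonneg hm', Real.norm_eq_abs]
    calc m q * _ ≤ m q * (K * F *
          (Real.exp (δ * q.2) * (Real.exp (δ * q.1) + Real.exp (-(δ * q.1))))) := by
          refine mul_le_mul_of_nonneg_left (h1.trans ?_) hm'
          exact mul_le_mul_of_nonneg_left h2 (by positivity)
      _ = K * F * G q := by
          simp only [hG, m]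
          rw [← payoffWeight_mul_exp r δ, add_mul, sub_mul, Real.exp_add, sub_eq_add_neg,
            Real.exp_add]
          ring
  have hd : Integrable (fun q => H q - κ * sqrtExpProfile (2 * √(a * r)) k * m q) π :=
    Integrable.mono' (hGi.const_mul _) (hH.aestronglyMeasurable.sub
      (hm0.const_mul _).aestronglyMeasurable) hbd
  have hHi : Integrable H π := by
    refine (hd.add (hm0.const_mul (κ * sqrtExpProfile (2 * √(a * r)) k))).congr
      (Eventually.of_forall fun q => ?_)
    simp [m]
  refine ⟨hHi, ?_⟩
  have hmi : ∫ q, m q ∂π = (∫ z, Real.exp (r * z) ∂ζ) * (1 / (r * (r - 1))) := by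
    rw [← integral_payoffWeight hr, ← integral_prod_mul]
  rw [← hmi, ← integral_const_mul, ← integral_sub hHi (hm0.const_mul _), ← Real.norm_eq_abs]
  refine (norm_integral_le_of_norm_le (hGi.const_mul _) hbd).trans ?_
  rw [integral_const_mul]
  have : 0 ≤ K * F := by positivity
  nlinarith

/-- Used to discard the atom of the compound law. It suffices that `e^k ≥ k² / 2`, as the profile is
at least `k^{-3/4}`. -/
theorem exp_neg_le_sqrtExpProfile_div {c k : ℝ} (hc : 0 ≤ c) (hk : 1 ≤ k) :
    Real.exp (-k) ≤ 2 * (sqrtExpProfile c k / √k) := by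
  have hk0 : 0 < k := by linarith
  have h1 := Real.quadratic_le_exp_of_nonneg hk0.le
  have h2 : 1 ≤ Real.exp (c * √k) := Real.one_le_exp (by positivity)
  have h3 : k ^ (3 / 4 : ℝ) * √k ≤ k * k := by
    have q1 : k ^ (3 / 4 : ℝ) ≤ k := by
      simpa using Real.rpow_le_rpow_of_exponent_le hk (by norm_num : (3 / 4 : ℝ) ≤ 1)
    have q2 : √k ≤ k := Real.sqrt_le_iff.2 ⟨hk0.le, by nlinarith⟩
    gcongr
  have hq : 0 < k ^ (3 / 4 : ℝ) * √k := by positivity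
  have e : 2 * (sqrtExpProfile c k / √k) = 2 * Real.exp (c * √k) / (k ^ (3 / 4 : ℝ) * √k) := by
    rw [sqrtExpProfile, Real.rpow_neg hk0.le]; field_simp
  rw [e, Real.exp_neg, ← one_div, div_le_div_iff₀ (Real.exp_pos _) hq]
  nlinarith

/-- Call prices when the log-return is an independent sum of `ζ` and a compound Poisson law with
exponential jumps. -/
theorem exists_abs_integral_callPayoff_sub_le [IsProbabilityMeasure ζ]
    (ha : 0 < a) (hr : 1 < r)
    (hζ : ∀ s, 0 ≤ s → Integrable (fun z => Real.exp (s * z)) ζ) :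
    ∃ K k₀ : ℝ, 0 < K ∧ 1 ≤ k₀ ∧ ∀ k, k₀ ≤ k →
      |Real.exp a * Real.exp ((r - 1) * k) *
          (∫ x, callPayoff k x ∂(ζ ∗ compoundExpLaw a r)) -
        (a * r) ^ (1 / 4 : ℝ) / (2 * √Real.pi) * sqrtExpProfile (2 * √(a * r)) k *
          ((∫ z, Real.exp (r * z) ∂ζ) * (1 / (r * (r - 1))))| ≤
        K * (sqrtExpProfile (2 * √(a * r)) k / √k) := by
  obtain ⟨K, k₀, hK, hk₀, h⟩ := exists_abs_integral_tiltedDensity_sub_le ha hr hζ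
  have hA : 0 < a * r := mul_pos ha (by linarith)
  set M := ∫ z, Real.exp ((1 + r) * z) ∂ζ
  have hM : 0 ≤ M := integral_nonneg fun z => (Real.exp_pos _).le
  -- The extra `2 M` accounts for the atom: its normalized contribution is at most `e^{-k} M`.
  refine ⟨K + 2 * M, k₀, by positivity, hk₀, fun k hk => ?_⟩
  obtain ⟨hi, hle⟩ := h k hk
  have hk1 : 1 ≤ k := hk₀.trans hk
  set π := ζ.prod (volume.restrict (Set.Ioi (0 : ℝ))) with hπ
  have hpos : ∀ᵐ q ∂π, 0 < q.2 := by
    have h1 : ∀ᵐ w ∂(volume.restrict (Set.Ioi (0 : ℝ))), 0 < w :=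
      ae_restrict_mem measurableSet_Ioi
    exact Measure.quasiMeasurePreserving_snd.ae h1
  have hH0 : 0 ≤ᵐ[π] fun q : ℝ × ℝ => Real.exp (r * q.1) * payoffWeight r q.2 *
      tiltedDensity (a * r) (k + (q.2 - q.1)) := by
    filter_upwards [hpos] with q hq
    exact mul_nonneg (mul_nonneg (Real.exp_pos _).le (payoffWeight_nonneg r hq.le))
      (tiltedDensity_nonneg hA.le _)
  have hpay : Integrable (callPayoff k) ζ := by
    refine Integrable.mono' ((hζ (1 + r) (by linarith)).const_mul (Real.exp (-(r * k))))
      (measurable_callPayoff k).aestronglyMeasurable (Eventually.of_forall fun x => ?_)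
    rw [Real.norm_of_nonneg (callPayoff_nonneg k x)]
    exact callPayoff_le_exp k x (by linarith)
  have hatom : ∫ z, callPayoff k z ∂ζ ≤ Real.exp (-(r * k)) * M := by
    rw [← integral_const_mul]
    exact integral_mono hpay ((hζ (1 + r) (by linarith)).const_mul _)
      fun x => callPayoff_le_exp k x (by linarith)
  have hatom0 : 0 ≤ ∫ z, callPayoff k z ∂ζ := integral_nonneg (callPayoff_nonneg k)
  have hint0 := integral_nonneg_of_ae hH0
  rw [integral_eq_lintegral_of_nonneg_ae (Eventually.of_forall (callPayoff_nonneg k))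
      (measurable_callPayoff k).aestronglyMeasurable, lintegral_callPayoff_conv ha.le (by linarith),
    ← ofReal_integral_eq_lintegral_ofReal hpay (Eventually.of_forall (callPayoff_nonneg k)),
    ← ofReal_integral_eq_lintegral_ofReal hi hH0, ← ENNReal.ofReal_mul (Real.exp_pos _).le,
    ← ENNReal.ofReal_add hatom0 (mul_nonneg (Real.exp_pos _).le hint0),
    ← ENNReal.ofReal_mul (Real.exp_pos _).le, ENNReal.toReal_ofReal (mul_nonneg (Real.exp_pos _).le
      (add_nonneg hatom0 (mul_nonneg (Real.exp_pos _).le hint0)))]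
  set I := ∫ q : ℝ × ℝ, Real.exp (r * q.1) * payoffWeight r q.2 *
      tiltedDensity (a * r) (k + (q.2 - q.1)) ∂π
  set B := ∫ z, callPayoff k z ∂ζ
  have e : Real.exp a * Real.exp ((r - 1) * k) *
      (Real.exp (-a) * (B + Real.exp (-((r - 1) * k)) * I)) = Real.exp ((r - 1) * k) * B + I := by
    rw [Real.exp_neg, Real.exp_neg]
    field_simp
  have hB : Real.exp ((r - 1) * k) * B ≤ 2 * M * (sqrtExpProfile (2 * √(a * r)) k / √k) := by
    calc Real.exp ((r - 1) * k) * B ≤ Real.exp ((r - 1) * k) * (Real.exp (-(r * k)) * M) := by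
          gcongr
      _ = Real.exp (-k) * M := by rw [← mul_assoc, ← Real.exp_add]; ring_nf
      _ ≤ 2 * (sqrtExpProfile (2 * √(a * r)) k / √k) * M := by
          gcongr; exact exp_neg_le_sqrtExpProfile_div (by positivity) hk1
      _ = _ := by ring
  have hB0 : 0 ≤ Real.exp ((r - 1) * k) * B := mul_nonneg (Real.exp_pos _).le hatom0
  rw [e, add_sub_assoc, add_mul]
  refine (abs_add_le _ _).trans ?_
  rw [abs_of_nonneg hB0]
  linarith

end Tail

/-! ### Identification of the constants and conclusion -/

/-- The claimed leading term, rewritten in terms of the Laplace transform of the diffusive part. -/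
theorem exp_kouAlpha_mul_rpow_eq {b σ lam lamPlus lamMinus p T k : ℝ} (hlam : 0 < lam)
    (hlamPlus : 1 < lamPlus) (hlamMinus : 0 < lamMinus) (hp0 : 0 < p) (hp1 : p < 1) (hT : 0 < T) :
    Real.exp (-kouAlphaOne lamPlus * k - kouAlphaHalf lam lamPlus p T * k ^ (1 / 2 : ℝ)
        - kouAlphaZero b σ lam lamPlus lamMinus p T) * k ^ (-(3 / 4) : ℝ) =
      Real.exp (-(lam * T * p)) * Real.exp (-((lamPlus - 1) * k)) *
        ((lam * T * p * lamPlus) ^ (1 / 4 : ℝ) / (2 * √Real.pi) *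
          sqrtExpProfile (2 * √(lam * T * p * lamPlus)) k *
          ((∫ z, Real.exp (lamPlus * z) ∂(diffusiveLaw b σ T (lam * T * (1 - p)) lamMinus)) *
            (1 / (lamPlus * (lamPlus - 1))))) := by
  have h1 : 0 < lamPlus - 1 := by linarith
  have h0 : 0 < lamPlus := by linarith
  have hpi : 0 < √Real.pi := Real.sqrt_pos.2 Real.pi_pos
  have hA : 0 < lam * lamPlus * p * T := by positivity
  have ha' : 0 ≤ lam * T * (1 - p) := mul_nonneg (by positivity) (by linarith)
  have hq : 0 < (lam * lamPlus * p * T) ^ (1 / 4 : ℝ) /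
      (2 * √Real.pi * lamPlus * (lamPlus - 1)) := by positivity
  have hs : lamMinus + lamPlus ≠ 0 := by positivity
  rw [integral_exp_diffusiveLaw hT.le ha' hlamMinus (by linarith), kouAlphaOne, kouAlphaHalf,
    kouAlphaZero, sqrtExpProfile, show lam * T * p * lamPlus = lam * lamPlus * p * T by ring,
    ← Real.sqrt_eq_rpow, ← Real.sqrt_eq_rpow]
  -- The term `λT` of `α₀` is split as `λTp + λT(1 - p)`: the first piece normalizes the compound
  -- law, the second belongs to the Laplace transform of the diffusive part.
  rw [show -(lamPlus - 1) * k - -2 * √(lam * lamPlus * p * T) * √k -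
      (T * (-(σ ^ 2 * lamPlus ^ 2 / 2) - b * lamPlus - lam * lamMinus * (1 - p) /
        (lamMinus + lamPlus) + lam) - Real.log ((lam * lamPlus * p * T) ^ (1 / 4 : ℝ) /
          (2 * √Real.pi * lamPlus * (lamPlus - 1)))) =
      -(lam * T * p) + -((lamPlus - 1) * k) + 2 * √(lam * lamPlus * p * T) * √k +
        (b * T * lamPlus + σ ^ 2 * T * lamPlus ^ 2 / 2 +
          (lam * T * (1 - p) * (lamMinus / (lamMinus + lamPlus)) - lam * T * (1 - p))) +
        Real.log ((lam * lamPlus * p * T) ^ (1 / 4 : ℝ) /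
          (2 * √Real.pi * lamPlus * (lamPlus - 1))) by ring, Real.exp_add, Real.exp_log hq,
    Real.exp_add, Real.exp_add, Real.exp_add]
  field_simp

theorem mainTheorem1 {Ω : Type*} [MeasurableSpace Ω] (P : Measure Ω) [IsProbabilityMeasure P]
    (W : ℝ≥0 → Ω → ℝ) (N : ℝ≥0 → Ω → ℕ) (Y : ℕ → Ω → ℝ)
    (b σ : ℝ) (lam : ℝ≥0) (lamPlus lamMinus p : ℝ) (T : ℝ≥0)
    (hσ : 0 < σ) (hlam : 0 < lam) (hlamPlus : 1 < lamPlus) (hlamMinus : 0 < lamMinus)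
    (hp0 : 0 < p) (hp1 : p < 1) (hT : 0 < T)
    (hmodel : IsKouModel P W N Y lam lamPlus lamMinus p) :
    (∀ k : ℝ, Integrable
      (fun ω => max (Real.exp (logReturn b σ W N Y T ω) - Real.exp k) 0) P) ∧
    ∃ r : ℝ → ℝ, r =O[atTop] (fun k : ℝ => k ^ (-(1 / 4) : ℝ)) ∧
      ∀ k : ℝ, 0 < k →
        callPrice P (logReturn b σ W N Y) k T =
          Real.exp (-kouAlphaOne lamPlus * k - kouAlphaHalf lam lamPlus p T * k ^ (1 / 2 : ℝ)
              - kouAlphaZero b σ lam lamPlus lamMinus p T)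
            * k ^ (-(3 / 4) : ℝ) * (1 + r k) := by
  have hlp0 : 0 < lamPlus := by linarith
  have hlam' : 0 < (lam : ℝ) := hlam
  have hT' : 0 < (T : ℝ) := hT
  have ha : 0 < (lam * T * p : ℝ) := by positivity
  have ha' : 0 ≤ (lam * T * (1 - p) : ℝ) := mul_nonneg (by positivity) (by linarith)
  have := isProbabilityMeasure_diffusiveLaw b σ T ha' hlamMinus
  have := isProbabilityMeasure_compoundExpLaw ha.le hlp0
  have hX := hmodel.measurable_logReturn b σ T
  have hlaw := hmodel.map_logReturn b σ T hlp0 hlamMinus hp0 hp1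
  set ζ := diffusiveLaw b σ T (lam * T * (1 - p)) lamMinus with hζdef
  have hζ : ∀ s, 0 ≤ s → Integrable (fun z => Real.exp (s * z)) ζ := fun s hs =>
    integrable_exp_diffusiveLaw ha' hlamMinus (by linarith)
  refine ⟨fun k => ?_, ?_⟩
  · have hexp : Integrable (fun x => Real.exp (1 * x)) (P.map (logReturn b σ W N Y T)) := by
      rw [hlaw]
      exact integrable_exp_conv (hζ 1 zero_le_one)
        (integrable_exp_compoundExpLaw ha.le hlp0.le hlamPlus)
    refine Integrable.mono' (hexp.comp_measurable hX) (by fun_prop)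
      (Eventually.of_forall fun ω => ?_)
    have := callPayoff_le_exp k (logReturn b σ W N Y T ω) le_rfl
    rw [Real.norm_of_nonneg (le_max_right _ _)]
    simpa [callPayoff] using this
  have hprice (k : ℝ) : callPrice P (logReturn b σ W N Y) k T =
      ∫ x, callPayoff k x ∂(ζ ∗ compoundExpLaw (lam * T * p) lamPlus) := by
    rw [← hlaw, integral_map hX.aemeasurable (measurable_callPayoff k).aestronglyMeasurable]
    rfl
  obtain ⟨K, k₀, hK, hk₀, hb⟩ := exists_abs_integral_callPayoff_sub_le ha hlamPlus hζ
  set C := callPrice P (logReturn b σ W N Y)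
  set κ := (lam * T * p * lamPlus : ℝ) ^ (1 / 4 : ℝ) / (2 * √Real.pi)
  set c := 2 * √(lam * T * p * lamPlus : ℝ)
  set m := (∫ z, Real.exp (lamPlus * z) ∂ζ) * (1 / (lamPlus * (lamPlus - 1))) with hm
  have hκ : 0 < κ := by have := Real.sqrt_pos.2 Real.pi_pos; positivity
  have hm0 : 0 < m := by
    have h1 : 0 < lamPlus - 1 := by linarith
    rw [hm, hζdef, integral_exp_diffusiveLaw hT'.le ha' hlamMinus (by linarith)]
    positivity
  set L : ℝ → ℝ := fun k => Real.exp (-(lam * T * p)) * Real.exp (-((lamPlus - 1) * k)) *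
    (κ * sqrtExpProfile c k * m) with hL
  have hLpos {k : ℝ} (hk : 0 < k) : 0 < L k := by
    have := sqrtExpProfile_pos c hk
    simp only [hL]
    positivity
  -- The remainder is the exact relative error, so the identity holds for every `k > 0`; only its
  -- size needs `k ≥ k₀`.
  refine ⟨fun k => C k T / L k - 1, ?_, fun k hk => ?_⟩
  · refine IsBigO.of_bound (K / (κ * m)) ?_
    filter_upwards [eventually_ge_atTop k₀] with k hk
    have hk1 : 1 ≤ k := hk₀.trans hk
    have hk0 : 0 < k := by linarith
    have hf := sqrtExpProfile_pos c hk0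
    have h := hb k hk
    rw [← hprice] at h
    have e : C k T / L k - 1 = (Real.exp (lam * T * p) * Real.exp ((lamPlus - 1) * k) * C k T -
        κ * sqrtExpProfile c k * m) / (κ * sqrtExpProfile c k * m) := by
      simp only [hL, Real.exp_neg]
      field_simp
    have hden : 0 < κ * sqrtExpProfile c k * m := by positivity
    rw [e, norm_div, Real.norm_eq_abs, Real.norm_of_nonneg hden.le,
      Real.norm_of_nonneg (by positivity)]
    -- The proved rate `k^{-1/2}` is weakened here to the stated one.
    have hsq : 1 / √k ≤ k ^ (-(1 / 4) : ℝ) := by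
      rw [Real.sqrt_eq_rpow, one_div, ← Real.rpow_neg hk0.le]
      exact Real.rpow_le_rpow_of_exponent_le hk1 (by norm_num)
    calc _ ≤ K * (sqrtExpProfile c k / √k) / (κ * sqrtExpProfile c k * m) := by gcongr
      _ = K / (κ * m) * (1 / √k) := by field_simp
      _ ≤ _ := by gcongr
  · rw [exp_kouAlpha_mul_rpow_eq hlam' hlamPlus hlamMinus hp0 hp1 hT']
    change C k T = L k * (1 + (C k T / L k - 1))
    have := (hLpos hk).ne'
    field_simp
    ring
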